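/- Let $N\ge 1$ be an integer, $s\in(0,1)$, $q\in(1,2)$, and let $\Omega\subset\mathbb R^N$ be a non-empty open set. For $u:\mathbb R^N\to\mathbb R$ put $$E_s(u)=\int_{\mathbb R^N}\int_{\mathbb R^N}\frac{(u(x)-u(y))^2}{|x-y|^{N+2s}}\,dx\,dy ,\qquad \lambda_1=\lambda_1(\Omega,s,q)=\inf\Big\{E_s(\varphi):\varphi\in C^\infty_0(\Omega),\ \int_\Omega|\varphi|^q\,dx=1\Big\},$$ and assume $\lambda_1>0$. Let $\mathcal D^{s,2}_0(\Omega)$ be the completion of $C^\infty_0(\Omega)$ with respect to the norm $E_s^{1/2}$; since $\lambda_1>0$, it is a space of functions on $\mathbb R^N$ (modulo equality a.e.), namely of those $u$ for which there are $\varphi_n\in C_0^\infty(\Omega)$ with $E_s(\varphi_n-u)\to0$ and $\varphi_n\to u$ a.e. A number $\lambda>0$ is a $q$-semilinear $s$-eigenvalue of $\Omega$, with eigenfunction $u$, if $u\in\mathcal D^{s,2}_0(\Omega)\cap L^q(\Omega)$, $u\neq0$, and $$\int_{\mathbb R^N}\int_{\mathbb R^N}\frac{(u(x)-u(y))(\varphi(x)-\varphi(y))}{|x-y|^{N+2s}}\,dx\,dy=\lambda\,\|u\|_{L^q(\Omega)}^{2-q}\int_\Omega|u|^{q-2}u\,\varphi\,dx\qquad\text{for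 all }\varphi\in\mathcal D^{s,2}_0(\Omega).$$ Then: 1. $\lambda_1<\infty$, and $\lambda_1$ is the minimum of $E_s$ over $\{u\in\mathcal D^{s,2}_0(\Omega):\int_\Omega|u|^q\,dx=1\}$; in particular it is attained there. 2. $\lambda_1$ is the least $q$-semilinear $s$-eigenvalue of $\Omega$, and its eigenfunctions are precisely the non-zero multiples of the minimisers in (1). 3. The minimiser, and likewise the eigenfunction of $\lambda_1$, is unique up to a non-zero multiplicative constant. 4. Every eigenfunction of $\lambda_1$ has constant sign: it is either $>0$ a.e. in $\Omega$ or $<0$ a.e. in $\Omega$. 5. $\lambda_1$ is the only $q$-semilinear $s$-eigenvalue that has an eigenfunction of constant sign: if $u$ is an eigenfunction with eigenvalue $\lambda$ and $u\ge0$ a.e. in $\Omega$ or $u\le 0$ a.e. in $\Omega$, then $\lambda=\lambda_1$. -/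

import Mathlib

open MeasureTheory Filter Topology
open scoped ENNReal ContDiff

namespace FracEig

/-- `φ ∈ C^∞_0(Ω)`: smooth with compact support contained in `Ω`. -/
def IsTestFunction {N : ℕ} (Ω : Set (EuclideanSpace ℝ (Fin N)))
    (φ : EuclideanSpace ℝ (Fin N) → ℝ) : Prop :=
  ContDiff ℝ ∞ φ ∧ HasCompactSupport φ ∧ tsupport φ ⊆ Ω

/-- The double integral of `(u(x) - u(y))² / |x - y|^(N + 2s)` over `ℝ^N × ℝ^N`,
as an element of `[0, ∞]`. -/
noncomputable def energy {N : ℕ} (s : ℝ) (u : EuclideanSpace ℝ (Fin N) → ℝ) : ℝ≥0∞ :=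
  ∫⁻ p : EuclideanSpace ℝ (Fin N) × EuclideanSpace ℝ (Fin N),
    ENNReal.ofReal ((u p.1 - u p.2) ^ 2 / ‖p.1 - p.2‖ ^ ((N : ℝ) + 2 * s))

/-- The double integral of `(u(x) - u(y)) (φ(x) - φ(y)) / |x - y|^(N + 2s)` over `ℝ^N × ℝ^N`.
The integrand is integrable as soon as `u` and `φ` have finite energy. -/
noncomputable def energyForm {N : ℕ} (s : ℝ) (u φ : EuclideanSpace ℝ (Fin N) → ℝ) : ℝ :=
  ∫ p : EuclideanSpace ℝ (Fin N) × EuclideanSpace ℝ (Fin N),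
    (u p.1 - u p.2) * (φ p.1 - φ p.2) / ‖p.1 - p.2‖ ^ ((N : ℝ) + 2 * s)

/-- The first eigenvalue
`λ₁(Ω, s, q) = inf { energy s φ : φ ∈ C^∞_0(Ω), ∫_Ω |φ|^q = 1 }`, as an element of `[0, ∞]`. -/
noncomputable def lambdaOne {N : ℕ} (Ω : Set (EuclideanSpace ℝ (Fin N))) (s q : ℝ) : ℝ≥0∞ :=
  sInf {e | ∃ φ : EuclideanSpace ℝ (Fin N) → ℝ,
    IsTestFunction Ω φ ∧ ∫ x in Ω, |φ x| ^ q = 1 ∧ e = energy s φ}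

/-- The completion `D^{s,2}_0(Ω)` of `C^∞_0(Ω)` in the norm `energy ^ (1/2)`, realised as a space
of functions on `ℝ^N` (up to equality almost everywhere): those `u` that are the limit, in that
norm and almost everywhere, of a sequence of test functions.

If `λ₁(Ω, s, q) > 0` for some `q ≥ 1`, then a sequence of test functions that is Cauchy in this
norm is Cauchy in `L^q(Ω)`, so that every element of the abstract completion is represented by
exactly one such function modulo equality a.e. -/
def D0 {N : ℕ} (Ω : Set (EuclideanSpace ℝ (Fin N))) (s : ℝ) :
    Set (EuclideanSpace ℝ (Fin N) → ℝ) :=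
  {u | ∃ φ : ℕ → EuclideanSpace ℝ (Fin N) → ℝ,
    (∀ n, IsTestFunction Ω (φ n)) ∧
    Tendsto (fun n => energy s (φ n - u)) atTop (𝓝 0) ∧
    ∀ᵐ x, Tendsto (fun n => φ n x) atTop (𝓝 (u x))}

/-- The constraint set `{u ∈ D^{s,2}_0(Ω) : ∫_Ω |u|^q = 1}`. (As the Bochner integral of a
non-integrable function is `0`, the condition entails that `|u|^q` is integrable on `Ω`.) -/
def constraintSet {N : ℕ} (Ω : Set (EuclideanSpace ℝ (Fin N))) (s q : ℝ) :
    Set (EuclideanSpace ℝ (Fin N) → ℝ) :=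
  {u | u ∈ D0 Ω s ∧ ∫ x in Ω, |u x| ^ q = 1}

/-- `u` achieves the minimum that defines `λ₁(Ω, s, q)`. -/
def IsMinimiser {N : ℕ} (Ω : Set (EuclideanSpace ℝ (Fin N))) (s q : ℝ)
    (u : EuclideanSpace ℝ (Fin N) → ℝ) : Prop :=
  u ∈ constraintSet Ω s q ∧ energy s u = lambdaOne Ω s q

/-- `u` is a `q`-semilinear `s`-eigenfunction with eigenvalue `lam > 0`: a non-trivial weak
solution in `D^{s,2}_0(Ω)` of `(-Δ)^s u = lam ‖u‖_{L^q(Ω)}^(2-q) |u|^(q-2) u`. -/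
structure IsEigenfunction {N : ℕ} (Ω : Set (EuclideanSpace ℝ (Fin N))) (s q : ℝ) (lam : ℝ)
    (u : EuclideanSpace ℝ (Fin N) → ℝ) : Prop where
  pos : 0 < lam
  mem : u ∈ D0 Ω s
  integrableOn : IntegrableOn (fun x => |u x| ^ q) Ω
  nontrivial : ¬ u =ᵐ[volume] 0
  weak : ∀ φ ∈ D0 Ω s,
    energyForm s u φ =
      lam * ((∫ x in Ω, |u x| ^ q) ^ (1 / q)) ^ (2 - q) *
        ∫ x in Ω, |u x| ^ (q - 2) * u x * φ x

/-- The `q`-semilinear `s`-spectrum of `Ω`. -/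
def spectrum {N : ℕ} (Ω : Set (EuclideanSpace ℝ (Fin N))) (s q : ℝ) : Set ℝ :=
  {lam | ∃ u, IsEigenfunction Ω s q lam u}

end FracEig

/-! The argument rests on one quadratic structure, one lattice inequality and one convexity fact.
The energy is the squared `L²` norm of `diffQuot`, hence a quadratic form that is lower
semicontinuous under a.e. convergence. The space `D0` contains every a.e. limit of compactly
supported continuous functions with bounded energy (`mem_D0_of_tendsto`): mollify, pass to convex
combinations that are Cauchy in energy, and apply Fatou. So `D0` is stable under Lipschitz
operations, and the Poincaré inequality `L ‖u‖_q² ≤ E(u)`, with `L = λ₁`, holds on all of it.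

No compact embedding is used for existence. For nonnegative normalised `u`, `v` put `A = ∫
max(u,v)^q` and `B = ∫ min(u,v)^q`. Then `A + B = 2`, while `L (A^(2/q) + B^(2/q)) ≤ E(max) + E(min)
≤ E(u) + E(v)`. Since `2/q > 1`, strict convexity forces `A - B = ∫ |u^q - v^q|` to be small as soon
as both energies are near `L`. Hence the `q`-th powers of the absolute values of a minimising
sequence are Cauchy in `L¹`, and the limit is a minimiser. The equality case of the same chain gives
uniqueness: two nonnegative minimisers are ordered a.e. and have equal norm, so they coincide.

The equation at level `λ₁` is the Euler–Lagrange equation, and testing an eigenvalue equation with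
the normalised eigenfunction shows that its eigenvalue is its energy. A minimiser has a sign because
`E(|u|) = E(u)` excludes sign changes. It cannot vanish on a set of positive measure, because there
a perturbation `tφ` gains order `t^q` at cost `t²`.

For a nonnegative eigenfunction with an arbitrary eigenvalue, test with `φ²/(u+ε)`. The nonlocal
Picone identity yields positivity of `u` and, as `ε → 0`, `λ ∫ u^(q-2) φ² ≤ E(φ)`. Young's
inequality with `‖u‖_q = ‖φ‖_q = 1` gives `∫ u^(q-2) φ² ≥ 1`, so `λ ≤ E(φ)` for every admissible
`φ`, that is `λ ≤ λ₁`. -/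

namespace FracEig

variable {N : ℕ} {s q lam : ℝ} {u v w φ : EuclideanSpace ℝ (Fin N) → ℝ}
  {Ω : Set (EuclideanSpace ℝ (Fin N))}

/-! ### The energy as a squared `L²` norm -/

/-- The square-root weighted difference `(u(x) - u(y)) / |x - y|^((N + 2s) / 2)`. -/
noncomputable def diffQuot (s : ℝ) (u : EuclideanSpace ℝ (Fin N) → ℝ)
    (p : EuclideanSpace ℝ (Fin N) × EuclideanSpace ℝ (Fin N)) : ℝ :=
  (u p.1 - u p.2) / ‖p.1 - p.2‖ ^ (((N : ℝ) + 2 * s) / 2)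

/-- The weighted difference of `u` is square integrable. -/
def HasFiniteEnergy (s : ℝ) (u : EuclideanSpace ℝ (Fin N) → ℝ) : Prop :=
  MemLp (diffQuot s u) 2 volume

lemma diffQuot_add (s : ℝ) (u v : EuclideanSpace ℝ (Fin N) → ℝ) :
    diffQuot s (u + v) = diffQuot s u + diffQuot s v := by
  ext p
  simp only [diffQuot, Pi.add_apply]
  ring

lemma diffQuot_sub (s : ℝ) (u v : EuclideanSpace ℝ (Fin N) → ℝ) :
    diffQuot s (u - v) = diffQuot s u - diffQuot s v := by
  ext p
  simp only [diffQuot, Pi.sub_apply]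
  ring

lemma diffQuot_smul (s c : ℝ) (u : EuclideanSpace ℝ (Fin N) → ℝ) :
    diffQuot s (c • u) = c • diffQuot s u := by
  ext p
  simp only [diffQuot, Pi.smul_apply, smul_eq_mul]
  ring

lemma rpow_half_mul_self {x : ℝ} (hx : 0 ≤ x) (a : ℝ) : x ^ (a / 2) * x ^ (a / 2) = x ^ a := by
  rw [← pow_two, ← Real.rpow_mul_natCast hx]
  congr 1
  push_cast
  ring

lemma diffQuot_mul (s : ℝ) (u v : EuclideanSpace ℝ (Fin N) → ℝ)
    (p : EuclideanSpace ℝ (Fin N) × EuclideanSpace ℝ (Fin N)) :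
    diffQuot s u p * diffQuot s v p =
      (u p.1 - u p.2) * (v p.1 - v p.2) / ‖p.1 - p.2‖ ^ ((N : ℝ) + 2 * s) := by
  rw [diffQuot, diffQuot, div_mul_div_comm, rpow_half_mul_self (norm_nonneg _)]

lemma diffQuot_sq (s : ℝ) (u : EuclideanSpace ℝ (Fin N) → ℝ)
    (p : EuclideanSpace ℝ (Fin N) × EuclideanSpace ℝ (Fin N)) :
    diffQuot s u p ^ 2 = (u p.1 - u p.2) ^ 2 / ‖p.1 - p.2‖ ^ ((N : ℝ) + 2 * s) := by
  rw [pow_two, diffQuot_mul, pow_two]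

lemma energy_eq_lintegral (s : ℝ) (u : EuclideanSpace ℝ (Fin N) → ℝ) :
    energy s u = ∫⁻ p, ENNReal.ofReal (diffQuot s u p ^ 2) := by
  simp only [energy, diffQuot_sq]

lemma energy_eq_eLpNorm (s : ℝ) (u : EuclideanSpace ℝ (Fin N) → ℝ) :
    energy s u = eLpNorm (diffQuot s u) 2 volume ^ 2 := by
  rw [energy_eq_lintegral, eLpNorm_eq_lintegral_rpow_enorm_toReal (by simp) (by simp)]
  simp only [ENNReal.toReal_ofNat, ENNReal.rpow_ofNat, one_div]
  rw [← ENNReal.rpow_mul_natCast]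
  norm_num
  refine lintegral_congr fun p => ?_
  rw [← ofReal_norm, ← ENNReal.ofReal_pow (norm_nonneg _), Real.norm_eq_abs, sq_abs]

lemma energyForm_eq_integral (s : ℝ) (u v : EuclideanSpace ℝ (Fin N) → ℝ) :
    energyForm s u v = ∫ p, diffQuot s u p * diffQuot s v p := by
  simp only [energyForm, diffQuot_mul]

lemma ae_fst_snd {P : EuclideanSpace ℝ (Fin N) → Prop} (h : ∀ᵐ x, P x) :
    ∀ᵐ p : EuclideanSpace ℝ (Fin N) × EuclideanSpace ℝ (Fin N), P p.1 ∧ P p.2 :=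
  (Measure.quasiMeasurePreserving_fst.ae h).and (Measure.quasiMeasurePreserving_snd.ae h)

lemma aemeasurable_diffQuot (s : ℝ) (hu : AEMeasurable u) : AEMeasurable (diffQuot s u) := by
  have h1 : AEMeasurable
      (fun p : EuclideanSpace ℝ (Fin N) × EuclideanSpace ℝ (Fin N) => u p.1) :=
    hu.comp_quasiMeasurePreserving Measure.quasiMeasurePreserving_fst
  have h2 : AEMeasurable
      (fun p : EuclideanSpace ℝ (Fin N) × EuclideanSpace ℝ (Fin N) => u p.2) :=
    hu.comp_quasiMeasurePreserving Measure.quasiMeasurePreserving_snd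
  exact (h1.sub h2).div (by fun_prop)

lemma diffQuot_congr (h : u =ᵐ[volume] v) : diffQuot s u =ᵐ[volume] diffQuot s v := by
  filter_upwards [ae_fst_snd h] with p hp
  rw [diffQuot, diffQuot, hp.1, hp.2]

lemma energy_congr (h : u =ᵐ[volume] v) : energy s u = energy s v := by
  rw [energy_eq_eLpNorm, energy_eq_eLpNorm, eLpNorm_congr_ae (diffQuot_congr h)]

lemma energyForm_congr {u' v' : EuclideanSpace ℝ (Fin N) → ℝ} (hu : u =ᵐ[volume] u')
    (hv : v =ᵐ[volume] v') : energyForm s u v = energyForm s u' v' := by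
  rw [energyForm_eq_integral, energyForm_eq_integral]
  exact integral_congr_ae ((diffQuot_congr hu).mul (diffQuot_congr hv))

lemma hasFiniteEnergy_of_lt_top (hu : AEMeasurable u) (h : energy s u < ⊤) :
    HasFiniteEnergy s u := by
  refine ⟨(aemeasurable_diffQuot s hu).aestronglyMeasurable, ?_⟩
  rw [energy_eq_eLpNorm] at h
  by_contra hc
  simp only [not_lt, top_le_iff] at hc
  simp [hc] at h

namespace HasFiniteEnergy

lemma energy_lt_top (hu : HasFiniteEnergy s u) : energy s u < ⊤ := by
  rw [energy_eq_eLpNorm]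
  exact ENNReal.pow_lt_top hu.2

lemma add (hu : HasFiniteEnergy s u) (hv : HasFiniteEnergy s v) : HasFiniteEnergy s (u + v) := by
  rw [HasFiniteEnergy, diffQuot_add]
  exact MemLp.add hu hv

lemma sub (hu : HasFiniteEnergy s u) (hv : HasFiniteEnergy s v) : HasFiniteEnergy s (u - v) := by
  rw [HasFiniteEnergy, diffQuot_sub]
  exact MemLp.sub hu hv

lemma smul (hu : HasFiniteEnergy s u) (c : ℝ) : HasFiniteEnergy s (c • u) := by
  rw [HasFiniteEnergy, diffQuot_smul]
  exact MemLp.const_smul hu c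

lemma integrable_mul (hu : HasFiniteEnergy s u) (hv : HasFiniteEnergy s v) :
    Integrable (fun p => diffQuot s u p * diffQuot s v p) :=
  MemLp.integrable_mul hu hv

lemma energyForm_add_left (hu : HasFiniteEnergy s u) (hv : HasFiniteEnergy s v)
    (hw : HasFiniteEnergy s w) : energyForm s (u + v) w = energyForm s u w + energyForm s v w := by
  simp only [energyForm_eq_integral, diffQuot_add, Pi.add_apply, add_mul]
  exact integral_add (hu.integrable_mul hw) (hv.integrable_mul hw)

end HasFiniteEnergy

lemma energyForm_comm (s : ℝ) (u v : EuclideanSpace ℝ (Fin N) → ℝ) :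
    energyForm s u v = energyForm s v u := by
  simp only [energyForm_eq_integral, mul_comm]

lemma energyForm_smul_left (s c : ℝ) (u v : EuclideanSpace ℝ (Fin N) → ℝ) :
    energyForm s (c • u) v = c * energyForm s u v := by
  simp only [energyForm_eq_integral, diffQuot_smul, Pi.smul_apply, smul_eq_mul, mul_assoc]
  exact integral_const_mul _ _

lemma energyForm_smul_right (s c : ℝ) (u v : EuclideanSpace ℝ (Fin N) → ℝ) :
    energyForm s u (c • v) = c * energyForm s u v := by
  rw [energyForm_comm, energyForm_smul_left, energyForm_comm]

lemma energyForm_self_nonneg (s : ℝ) (u : EuclideanSpace ℝ (Fin N) → ℝ) :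
    0 ≤ energyForm s u u := by
  rw [energyForm_eq_integral]
  exact integral_nonneg fun p => mul_self_nonneg _

lemma HasFiniteEnergy.energy_eq_ofReal (hu : HasFiniteEnergy s u) :
    energy s u = ENNReal.ofReal (energyForm s u u) := by
  rw [energyForm_eq_integral, ofReal_integral_eq_lintegral_ofReal (hu.integrable_mul hu)
    (Eventually.of_forall fun p => mul_self_nonneg _), energy_eq_lintegral]
  simp only [pow_two]

lemma HasFiniteEnergy.toReal_energy (hu : HasFiniteEnergy s u) :
    (energy s u).toReal = energyForm s u u := by
  rw [hu.energy_eq_ofReal, ENNReal.toReal_ofReal (energyForm_self_nonneg s u)]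

lemma HasFiniteEnergy.energyForm_add_self (hu : HasFiniteEnergy s u) (hv : HasFiniteEnergy s v) :
    energyForm s (u + v) (u + v) =
      energyForm s u u + 2 * energyForm s u v + energyForm s v v := by
  rw [hu.energyForm_add_left hv (hu.add hv), energyForm_comm s u, energyForm_comm s v,
    hu.energyForm_add_left hv hu, hu.energyForm_add_left hv hv, energyForm_comm s v u]
  ring

lemma HasFiniteEnergy.energyForm_parallelogram (hu : HasFiniteEnergy s u)
    (hv : HasFiniteEnergy s v) :
    energyForm s (u - v) (u - v) = 2 * energyForm s u u + 2 * energyForm s v v -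
      4 * energyForm s ((1 / 2 : ℝ) • u + (1 / 2 : ℝ) • v)
        ((1 / 2 : ℝ) • u + (1 / 2 : ℝ) • v) := by
  have h1 : u - v = u + (-1 : ℝ) • v := by ext x; simp; ring
  rw [h1, hu.energyForm_add_self (hv.smul _), (hu.smul _).energyForm_add_self (hv.smul _)]
  simp only [energyForm_smul_left, energyForm_smul_right]
  ring

/-- Lower semicontinuity of the energy with respect to convergence almost everywhere. -/
lemma energy_le_liminf {f : ℕ → EuclideanSpace ℝ (Fin N) → ℝ} (hf : ∀ n, AEMeasurable (f n))
    (h : ∀ᵐ x, Tendsto (fun n => f n x) atTop (𝓝 (u x))) :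
    energy s u ≤ liminf (fun n => energy s (f n)) atTop := by
  simp only [energy_eq_lintegral]
  calc ∫⁻ p, ENNReal.ofReal (diffQuot s u p ^ 2)
      = ∫⁻ p, liminf (fun n => ENNReal.ofReal (diffQuot s (f n) p ^ 2)) atTop := by
        refine lintegral_congr_ae ?_
        filter_upwards [ae_fst_snd h] with p hp
        refine (Tendsto.liminf_eq ?_).symm
        exact ENNReal.tendsto_ofReal (((hp.1.sub hp.2).div_const _).pow 2)
    _ ≤ _ := lintegral_liminf_le' fun n =>
        ((aemeasurable_diffQuot s (hf n)).pow_const 2).ennreal_ofReal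

/-- A pointwise Lipschitz bound on the increments bounds the energy. -/
lemma energy_le_of_abs_sub_le (hu : AEMeasurable u) {K : ℝ}
    (h : ∀ x y, |w x - w y| ≤ K * (|u x - u y| + |v x - v y|)) :
    energy s w ≤ ENNReal.ofReal (2 * K ^ 2) * (energy s u + energy s v) := by
  simp only [energy_eq_lintegral]
  rw [← lintegral_add_left' ((aemeasurable_diffQuot s hu).pow_const 2).ennreal_ofReal,
    ← lintegral_const_mul' _ _ ENNReal.ofReal_ne_top]
  refine lintegral_mono fun p => ?_
  rw [← ENNReal.ofReal_add (sq_nonneg _) (sq_nonneg _), ← ENNReal.ofReal_mul (by positivity)]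
  refine ENNReal.ofReal_le_ofReal ?_
  rw [diffQuot_sq, diffQuot_sq, diffQuot_sq, ← add_div, ← mul_div_assoc]
  have h1 := h p.1 p.2
  have h2 : (w p.1 - w p.2) ^ 2 ≤ (K * (|u p.1 - u p.2| + |v p.1 - v p.2|)) ^ 2 := by
    rw [← sq_abs (w p.1 - w p.2)]
    exact pow_le_pow_left₀ (abs_nonneg _) h1 2
  gcongr
  refine h2.trans ?_
  rw [mul_pow, ← sq_abs (u p.1 - u p.2), ← sq_abs (v p.1 - v p.2), mul_comm 2, mul_assoc]
  gcongr
  nlinarith [sq_nonneg (|u p.1 - u p.2| - |v p.1 - v p.2|)]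

/-! ### Test functions: finite energy and mollification -/

/-- In polar coordinates the integrand is `r^(1-2s)` near the origin, integrable as `s < 1`, and
`r^(-1-2s)` at infinity, integrable as `s > 0`. -/
lemma integrable_min_sq_div_norm_rpow (hN : 1 ≤ N) (hs : s ∈ Set.Ioo (0 : ℝ) 1) :
    Integrable (fun h : EuclideanSpace ℝ (Fin N) =>
      min (‖h‖ ^ 2) 1 / ‖h‖ ^ ((N : ℝ) + 2 * s)) := by
  have : Nonempty (Fin N) := ⟨⟨0, hN⟩⟩
  have : Nontrivial (EuclideanSpace ℝ (Fin N)) := inferInstance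
  refine (integrable_fun_norm_addHaar (volume : Measure (EuclideanSpace ℝ (Fin N)))
    (f := fun r : ℝ => min (r ^ 2) 1 / r ^ ((N : ℝ) + 2 * s))).2 ?_
  rw [finrank_euclideanSpace_fin, ← Set.Ioc_union_Ioi_eq_Ioi (zero_le_one (α := ℝ))]
  have key : ∀ y : ℝ, 0 < y → y ^ (N - 1) = y ^ ((N : ℝ) - 1) := fun y hy => by
    rw [← Real.rpow_natCast, Nat.cast_sub hN, Nat.cast_one]
  refine IntegrableOn.union ?_ ?_
  · have h1 : IntegrableOn (fun y : ℝ => y ^ (1 - 2 * s)) (Set.Ioc 0 1) := by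
      rw [← intervalIntegrable_iff_integrableOn_Ioc_of_le zero_le_one]
      exact intervalIntegral.intervalIntegrable_rpow' (by linarith [hs.2])
    refine h1.congr_fun (fun y hy => ?_) measurableSet_Ioc
    have : min (y ^ 2) 1 = y ^ (2 : ℝ) := by
      rw [Real.rpow_two]
      exact min_eq_left (pow_le_one₀ hy.1.le hy.2)
    simp only [smul_eq_mul]
    rw [key y hy.1, this, ← Real.rpow_sub hy.1, ← Real.rpow_add hy.1]
    congr 1
    ring
  · have h1 : IntegrableOn (fun y : ℝ => y ^ (-1 - 2 * s)) (Set.Ioi 1) :=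
      integrableOn_Ioi_rpow_of_lt (by linarith [hs.1]) one_pos
    refine h1.congr_fun (fun y hy => ?_) measurableSet_Ioi
    have hy1 : (1 : ℝ) < y := hy
    have hy0 : 0 < y := one_pos.trans hy1
    have : min (y ^ 2) 1 = 1 := min_eq_right (one_le_pow₀ hy1.le)
    simp only [smul_eq_mul]
    rw [key y hy0, this, one_div, ← Real.rpow_neg hy0.le, ← Real.rpow_add hy0]
    congr 1
    ring

/-- The increment is controlled by the Lipschitz constant for close points and by the sup norm for
distant ones, and it vanishes unless one point lies in the support. The energy is therefore at most
`2 |supp u|` times the integral of a translation-invariant kernel. -/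
lemma energy_lt_top_of_contDiff (hN : 1 ≤ N) (hs : s ∈ Set.Ioo (0 : ℝ) 1)
    (hu : ContDiff ℝ ∞ u) (hc : HasCompactSupport u) : energy s u < ⊤ := by
  obtain ⟨K, hK⟩ := ContDiff.lipschitzWith_of_hasCompactSupport hc hu (by simp)
  obtain ⟨M, hM⟩ := hc.exists_bound_of_continuous hu.continuous
  have hM0 : 0 ≤ M := (norm_nonneg _).trans (hM 0)
  -- `K²` serves the Lipschitz bound and `4M² = (2M)²` the sup bound.
  set C : ℝ := (K : ℝ) ^ 2 + 4 * M ^ 2 with hC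
  have hC0 : 0 ≤ C := by positivity
  set S := tsupport u
  have hS : MeasurableSet S := (isClosed_tsupport u).measurableSet
  have hSfin : volume S < ⊤ := hc.measure_lt_top
  set g : EuclideanSpace ℝ (Fin N) → ℝ≥0∞ := fun h =>
    ENNReal.ofReal (C * (min (‖h‖ ^ 2) 1 / ‖h‖ ^ ((N : ℝ) + 2 * s))) with hg
  have hgm : Measurable g := by fun_prop
  have hgfin : ∫⁻ h, g h < ⊤ :=
    ((integrable_min_sq_div_norm_rpow hN hs).const_mul C).lintegral_lt_top
  set i : EuclideanSpace ℝ (Fin N) → ℝ≥0∞ := S.indicator 1 with hi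
  have him : Measurable i := measurable_one.indicator hS
  have hiS : ∫⁻ x, i x = volume S := by simp [hi, lintegral_indicator hS]
  have hpt : ∀ p : EuclideanSpace ℝ (Fin N) × EuclideanSpace ℝ (Fin N),
      ENNReal.ofReal ((u p.1 - u p.2) ^ 2 / ‖p.1 - p.2‖ ^ ((N : ℝ) + 2 * s)) ≤
        i p.1 * g (p.1 - p.2) + i p.2 * g (p.1 - p.2) := by
    intro p
    by_cases hp : p.1 ∈ S ∨ p.2 ∈ S
    · have h1 : ENNReal.ofReal ((u p.1 - u p.2) ^ 2 / ‖p.1 - p.2‖ ^ ((N : ℝ) + 2 * s)) ≤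
          g (p.1 - p.2) := by
        refine ENNReal.ofReal_le_ofReal ?_
        rw [← mul_div_assoc]
        gcongr
        have hl : |u p.1 - u p.2| ≤ K * ‖p.1 - p.2‖ := by
          simpa [dist_eq_norm] using hK.dist_le_mul p.1 p.2
        have hb : |u p.1 - u p.2| ≤ 2 * M := by
          have h1 := hM p.1
          have h2 := hM p.2
          have h3 := norm_sub_le (u p.1) (u p.2)
          rw [Real.norm_eq_abs] at h3
          linarith
        have hl2 := pow_le_pow_left₀ (abs_nonneg _) hl 2
        have hb2 := pow_le_pow_left₀ (abs_nonneg _) hb 2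
        rw [sq_abs] at hl2 hb2
        rcases le_total (‖p.1 - p.2‖ ^ 2) 1 with h | h
        · rw [min_eq_left h]
          nlinarith [sq_nonneg ‖p.1 - p.2‖, sq_nonneg M,
            mul_nonneg (sq_nonneg M) (sq_nonneg ‖p.1 - p.2‖)]
        · rw [min_eq_right h]
          nlinarith [sq_nonneg (K : ℝ)]
      rcases hp with hp | hp
      · refine h1.trans (le_trans ?_ le_self_add)
        simp [hi, hp]
      · refine h1.trans (le_trans ?_ le_add_self)
        simp [hi, hp]
    · rw [not_or] at hp
      rw [image_eq_zero_of_notMem_tsupport hp.1, image_eq_zero_of_notMem_tsupport hp.2]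
      simp
  have hm1 : Measurable fun p : EuclideanSpace ℝ (Fin N) × EuclideanSpace ℝ (Fin N) =>
      i p.1 * g (p.1 - p.2) := by fun_prop
  have hm2 : Measurable fun p : EuclideanSpace ℝ (Fin N) × EuclideanSpace ℝ (Fin N) =>
      i p.2 * g (p.1 - p.2) := by fun_prop
  have hfin : volume S * ∫⁻ h, g h < ⊤ := ENNReal.mul_lt_top hSfin hgfin
  refine (lintegral_mono hpt).trans_lt ?_
  rw [lintegral_add_left hm1]
  refine ENNReal.add_lt_top.2 ⟨?_, ?_⟩
  · rw [Measure.volume_eq_prod, lintegral_prod _ hm1.aemeasurable]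
    have : ∀ x : EuclideanSpace ℝ (Fin N), ∫⁻ y, i x * g (x - y) = i x * ∫⁻ h, g h := fun x => by
      rw [lintegral_const_mul _ (by fun_prop), lintegral_sub_left_eq_self]
    simp only [this]
    rwa [lintegral_mul_const _ him, hiS]
  · rw [Measure.volume_eq_prod, lintegral_prod_symm _ hm2.aemeasurable]
    have : ∀ y : EuclideanSpace ℝ (Fin N), ∫⁻ x, i y * g (x - y) = i y * ∫⁻ h, g h := fun y => by
      rw [lintegral_const_mul _ (by fun_prop), lintegral_sub_right_eq_self]
    simp only [this]
    rwa [lintegral_mul_const _ him, hiS]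

open scoped Convolution in
/-- Mollification does not increase the energy. -/
lemma energy_normed_convolution_le (ρ : ContDiffBump (0 : EuclideanSpace ℝ (Fin N)))
    (hu : Continuous u) :
    energy s (ρ.normed volume ⋆[ContinuousLinearMap.lsmul ℝ ℝ, volume] u) ≤ energy s u := by
  set r : EuclideanSpace ℝ (Fin N) → ℝ := ρ.normed volume with hr
  have hrc : Continuous r := ρ.continuous_normed
  have hrs : HasCompactSupport r := ρ.hasCompactSupport_normed
  have hr0 : ∀ z, 0 ≤ r z := ρ.nonneg_normed
  have hr1 : ∫ z, r z = 1 := ρ.integral_normed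
  have hrI : Integrable r := hrc.integrable_of_hasCompactSupport hrs
  have hintg : ∀ f : EuclideanSpace ℝ (Fin N) → ℝ, Continuous f →
      Integrable fun z => r z * f z := fun f hf =>
    (hrc.mul hf).integrable_of_hasCompactSupport hrs.mul_right
  have hconv : ∀ x, (r ⋆[ContinuousLinearMap.lsmul ℝ ℝ, volume] u) x =
      ∫ z, r z * u (x - z) := fun x => by simp [convolution_def]
  -- Jensen for the probability density `r`, obtained by expanding the nonnegative weighted
  -- variance.
  have hjensen : ∀ f : EuclideanSpace ℝ (Fin N) → ℝ, Continuous f →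
      (∫ z, r z * f z) ^ 2 ≤ ∫ z, r z * f z ^ 2 := by
    intro f hf
    set m := ∫ z, r z * f z with hm
    have h0 : 0 ≤ ∫ z, r z * (f z - m) ^ 2 :=
      integral_nonneg fun z => mul_nonneg (hr0 z) (sq_nonneg _)
    have h1 : ∀ z, r z * (f z - m) ^ 2 = r z * f z ^ 2 - 2 * m * (r z * f z) + m ^ 2 * r z :=
      fun z => by ring
    simp only [h1] at h0
    have h2 : Integrable fun z => r z * f z ^ 2 := hintg (fun z => f z ^ 2) (by fun_prop)
    have h3 : Integrable fun z => r z * f z ^ 2 - 2 * m * (r z * f z) :=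
      h2.sub ((hintg f hf).const_mul _)
    rw [integral_add h3 (hrI.const_mul _), integral_sub h2 ((hintg f hf).const_mul _),
      integral_const_mul,
      integral_const_mul, hr1, ← hm] at h0
    nlinarith
  have hmeas : Measurable fun x : (EuclideanSpace ℝ (Fin N) × EuclideanSpace ℝ (Fin N)) ×
      EuclideanSpace ℝ (Fin N) => ENNReal.ofReal (r x.2) * ENNReal.ofReal
        ((u (x.1.1 - x.2) - u (x.1.2 - x.2)) ^ 2 / ‖x.1.1 - x.1.2‖ ^ ((N : ℝ) + 2 * s)) := by
    have := hu.measurable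
    have := hrc.measurable
    fun_prop
  have hpt : ∀ p : EuclideanSpace ℝ (Fin N) × EuclideanSpace ℝ (Fin N),
      ENNReal.ofReal (((r ⋆[ContinuousLinearMap.lsmul ℝ ℝ, volume] u) p.1 -
        (r ⋆[ContinuousLinearMap.lsmul ℝ ℝ, volume] u) p.2) ^ 2 /
          ‖p.1 - p.2‖ ^ ((N : ℝ) + 2 * s)) ≤
      ∫⁻ z, ENNReal.ofReal (r z) * ENNReal.ofReal
        ((u (p.1 - z) - u (p.2 - z)) ^ 2 / ‖p.1 - p.2‖ ^ ((N : ℝ) + 2 * s)) := by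
    intro p
    have e1 : ∀ z, ENNReal.ofReal (r z) * ENNReal.ofReal
        ((u (p.1 - z) - u (p.2 - z)) ^ 2 / ‖p.1 - p.2‖ ^ ((N : ℝ) + 2 * s)) = ENNReal.ofReal
        (r z * (u (p.1 - z) - u (p.2 - z)) ^ 2 / ‖p.1 - p.2‖ ^ ((N : ℝ) + 2 * s)) := fun z => by
      rw [← ENNReal.ofReal_mul (hr0 z), mul_div_assoc]
    simp only [e1]
    rw [← ofReal_integral_eq_lintegral_ofReal ((hintg _ (by fun_prop)).div_const _)
      (Eventually.of_forall fun z => div_nonneg (mul_nonneg (hr0 z) (sq_nonneg _))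
        (by positivity)), integral_div, hconv, hconv,
      ← integral_sub (hintg _ (by fun_prop)) (hintg _ (by fun_prop))]
    refine ENNReal.ofReal_le_ofReal ?_
    gcongr
    simp only [← mul_sub]
    exact hjensen (fun z => u (p.1 - z) - u (p.2 - z)) (by fun_prop)
  refine (lintegral_mono hpt).trans ?_
  rw [lintegral_lintegral_swap hmeas.aemeasurable]
  have hinner : ∀ z, ∫⁻ p : EuclideanSpace ℝ (Fin N) × EuclideanSpace ℝ (Fin N),
      ENNReal.ofReal (r z) * ENNReal.ofReal
        ((u (p.1 - z) - u (p.2 - z)) ^ 2 / ‖p.1 - p.2‖ ^ ((N : ℝ) + 2 * s)) =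
      ENNReal.ofReal (r z) * energy s u := by
    intro z
    rw [lintegral_const_mul' _ _ ENNReal.ofReal_ne_top]
    congr 1
    symm
    -- Translating both variables by `z` leaves the kernel unchanged.
    rw [energy, Measure.volume_eq_prod, ← lintegral_sub_right_eq_self _ (z, z)]
    refine lintegral_congr fun p => ?_
    simp
  simp only [hinner]
  rw [lintegral_mul_const _ hrc.measurable.ennreal_ofReal,
    ← ofReal_integral_eq_lintegral_ofReal hrI (Eventually.of_forall hr0), hr1]
  simp

lemma IsTestFunction.continuous (h : IsTestFunction Ω u) : Continuous u := h.1.continuous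

lemma IsTestFunction.hasFiniteEnergy (hN : 1 ≤ N) (hs : s ∈ Set.Ioo (0 : ℝ) 1)
    (h : IsTestFunction Ω u) : HasFiniteEnergy s u :=
  hasFiniteEnergy_of_lt_top h.continuous.aemeasurable (energy_lt_top_of_contDiff hN hs h.1 h.2.1)

lemma IsTestFunction.add (hu : IsTestFunction Ω u) (hv : IsTestFunction Ω v) :
    IsTestFunction Ω (u + v) :=
  ⟨hu.1.add hv.1, hu.2.1.add hv.2.1,
    (tsupport_add u v).trans (Set.union_subset hu.2.2 hv.2.2)⟩

lemma IsTestFunction.smul (hu : IsTestFunction Ω u) (c : ℝ) : IsTestFunction Ω (c • u) :=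
  ⟨hu.1.const_smul c, hu.2.1.smul_left (f := fun _ => c),
    (tsupport_smul_subset_right (fun _ => c) u).trans hu.2.2⟩

-- Mollify at a radius below both the modulus of uniform continuity for `ε` and the width of a
-- neighbourhood of the support that still lies in `Ω`.
open scoped Convolution Pointwise in
lemma exists_isTestFunction_approx (hΩ : IsOpen Ω) (hu : Continuous u)
    (hc : HasCompactSupport u) (hsub : tsupport u ⊆ Ω) (s : ℝ) {ε : ℝ} (hε : 0 < ε) :
    ∃ g, IsTestFunction Ω g ∧ (∀ x, |g x - u x| ≤ ε) ∧ energy s g ≤ energy s u := by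
  obtain ⟨δ₁, hδ₁, h₁⟩ := Metric.uniformContinuous_iff.1
    (hc.uniformContinuous_of_continuous hu) ε hε
  obtain ⟨δ₂, hδ₂, h₂⟩ := IsCompact.exists_cthickening_subset_open hc hΩ hsub
  have hδ : 0 < min δ₁ δ₂ := lt_min hδ₁ hδ₂
  let ρ : ContDiffBump (0 : EuclideanSpace ℝ (Fin N)) :=
    ⟨min δ₁ δ₂ / 2, min δ₁ δ₂, by linarith, by linarith⟩
  refine ⟨ρ.normed volume ⋆[ContinuousLinearMap.lsmul ℝ ℝ, volume] u, ⟨?_, ?_, ?_⟩, fun x => ?_,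
    energy_normed_convolution_le ρ hu⟩
  · exact ρ.hasCompactSupport_normed.contDiff_convolution_left _ ρ.contDiff_normed
      (hu.locallyIntegrable)
  · exact ρ.hasCompactSupport_normed.convolution _ hc
  · refine (closure_minimal ?_ Metric.isClosed_cthickening).trans h₂
    refine (support_convolution_subset _).trans ?_
    rintro _ ⟨a, ha, b, hb, rfl⟩
    rw [ρ.support_normed_eq, mem_ball_zero_iff] at ha
    refine Metric.mem_cthickening_of_dist_le _ b _ _ (subset_tsupport u hb) ?_
    rw [dist_eq_norm]
    simp only [add_sub_cancel_right]
    exact ha.le.trans (min_le_right _ _)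
  · rw [← Real.dist_eq]
    refine ρ.dist_normed_convolution_le hu.aestronglyMeasurable fun y hy => ?_
    exact (h₁ ((Metric.mem_ball.1 hy).trans_le (min_le_left _ _))).le

/-! ### Closure of `D0` under a.e. limits with bounded energy -/

lemma convexHull_isTestFunction {f : ℕ → EuclideanSpace ℝ (Fin N) → ℝ}
    (hf : ∀ n, IsTestFunction Ω (f n)) {S : Set ℕ} {g : EuclideanSpace ℝ (Fin N) → ℝ}
    (hg : g ∈ convexHull ℝ (f '' S)) : IsTestFunction Ω g := by
  refine convexHull_min (t := {g | IsTestFunction Ω g}) ?_ ?_ hg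
  · rintro _ ⟨n, -, rfl⟩
    exact hf n
  · intro a ha b hb c d _ _ _
    exact (IsTestFunction.smul ha c).add (IsTestFunction.smul hb d)

lemma tendsto_of_mem_convexHull_tail {f g : ℕ → EuclideanSpace ℝ (Fin N) → ℝ}
    (hg : ∀ n, g n ∈ convexHull ℝ (f '' Set.Ici n)) {x : EuclideanSpace ℝ (Fin N)} {a : ℝ}
    (h : Tendsto (fun n => f n x) atTop (𝓝 a)) : Tendsto (fun n => g n x) atTop (𝓝 a) := by
  rw [Metric.tendsto_atTop] at h ⊢
  intro ε hε
  obtain ⟨n₀, hn₀⟩ := h ε hε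
  refine ⟨n₀, fun n hn => ?_⟩
  refine convexHull_min (t := {g | g x ∈ Metric.ball a ε}) ?_ ?_ (hg n)
  · rintro _ ⟨k, hk, rfl⟩
    exact hn₀ k (hn.trans hk)
  · exact (convex_ball a ε).linear_preimage
      (LinearMap.proj (R := ℝ) (φ := fun _ : EuclideanSpace ℝ (Fin N) => ℝ) x)

/-- A sequence of test functions with bounded energy has tail convex combinations that form a
Cauchy sequence in energy. -/
lemma exists_convexHull_cauchy (hN : 1 ≤ N) (hs : s ∈ Set.Ioo (0 : ℝ) 1)
    {f : ℕ → EuclideanSpace ℝ (Fin N) → ℝ} (hf : ∀ n, IsTestFunction Ω (f n)) {C : ℝ}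
    (hC : ∀ n, energyForm s (f n) (f n) ≤ C) :
    ∃ g : ℕ → EuclideanSpace ℝ (Fin N) → ℝ, (∀ n, g n ∈ convexHull ℝ (f '' Set.Ici n)) ∧
      ∀ ε > 0, ∃ n₀, ∀ n ≥ n₀, ∀ m ≥ n, energyForm s (g n - g m) (g n - g m) ≤ ε := by
  set K : ℕ → Set (EuclideanSpace ℝ (Fin N) → ℝ) := fun n => convexHull ℝ (f '' Set.Ici n)
  have hKanti : ∀ {n m}, n ≤ m → K m ⊆ K n := fun hnm =>
    convexHull_mono (Set.image_mono (Set.Ici_subset_Ici.2 hnm))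
  have hfK : ∀ n, f n ∈ K n := fun n => subset_convexHull _ _ ⟨n, Set.self_mem_Ici, rfl⟩
  -- The least energy in the hull of the `n`-th tail increases with `n` and stays below `C`, so it
  -- converges. Near-minimisers are then Cauchy, as in the proof of the projection theorem in a
  -- Hilbert space.
  set d : ℕ → ℝ := fun n => sInf ((fun g => energyForm s g g) '' K n)
  have hbdd : ∀ n, BddBelow ((fun g => energyForm s g g) '' K n) := fun n =>
    ⟨0, by rintro _ ⟨g, -, rfl⟩; exact energyForm_self_nonneg s g⟩
  have hd : ∀ n, ∀ g ∈ K n, d n ≤ energyForm s g g := fun n g hg =>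
    csInf_le (hbdd n) ⟨g, hg, rfl⟩
  have hdmono : Monotone d := fun n m hnm =>
    csInf_le_csInf (hbdd n) ⟨_, f m, hfK m, rfl⟩ (Set.image_mono (hKanti hnm))
  have hdbdd : BddAbove (Set.range d) :=
    ⟨C, by rintro _ ⟨n, rfl⟩; exact (hd n _ (hfK n)).trans (hC n)⟩
  have hex : ∀ n : ℕ, ∃ g ∈ K n, energyForm s g g < d n + 1 / ((n : ℝ) + 1) := by
    intro n
    obtain ⟨_, ⟨g, hg, rfl⟩, h⟩ := exists_lt_of_csInf_lt
      (s := (fun g => energyForm s g g) '' K n) ⟨_, f n, hfK n, rfl⟩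
      (show d n < d n + 1 / ((n : ℝ) + 1) by linarith [Nat.one_div_pos_of_nat (α := ℝ) (n := n)])
    exact ⟨g, hg, h⟩
  choose g hgK hg using hex
  refine ⟨g, hgK, fun ε hε => ?_⟩
  have hlim := tendsto_atTop_ciSup hdmono hdbdd
  obtain ⟨n₁, hn₁⟩ := (Metric.tendsto_atTop.1 hlim) (ε / 4) (by positivity)
  obtain ⟨n₂, hn₂⟩ := exists_nat_one_div_lt (show 0 < ε / 8 by positivity)
  refine ⟨max n₁ n₂, fun n hn m hm => ?_⟩
  have hfe : ∀ n, HasFiniteEnergy s (g n) := fun n =>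
    (convexHull_isTestFunction hf (hgK n)).hasFiniteEnergy hN hs
  rw [(hfe n).energyForm_parallelogram (hfe m)]
  -- The midpoint of `g n` and `g m` stays in the `n`-th hull, so the parallelogram law leaves `2 (d
  -- m - d n)` plus the two slacks: `2·ε/4 + 4·ε/8 = ε`.
  have hmid := hd n _ ((convex_convexHull ℝ _) (hgK n) (hKanti hm (hgK m))
    (show (0 : ℝ) ≤ 1 / 2 by norm_num) (show (0 : ℝ) ≤ 1 / 2 by norm_num) (by norm_num))
  have h1 : 1 / ((n : ℝ) + 1) ≤ ε / 8 := (Nat.one_div_le_one_div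
    ((le_max_right _ _).trans hn)).trans hn₂.le
  have h2 : 1 / ((m : ℝ) + 1) ≤ ε / 8 := (Nat.one_div_le_one_div
    ((le_max_right _ _).trans (hn.trans hm))).trans hn₂.le
  have h3 := hn₁ n ((le_max_left _ _).trans hn)
  rw [Real.dist_eq, abs_lt] at h3
  have h4 := le_ciSup hdbdd m
  linarith [hg n, hg m]

/-- `D^{s,2}_0(Ω)` contains the limits almost everywhere of sequences of continuous functions with
compact support in `Ω` and bounded energy. -/
lemma mem_D0_of_tendsto (hN : 1 ≤ N) (hs : s ∈ Set.Ioo (0 : ℝ) 1) (hΩ : IsOpen Ω)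
    {f : ℕ → EuclideanSpace ℝ (Fin N) → ℝ} (hf : ∀ n, Continuous (f n))
    (hc : ∀ n, HasCompactSupport (f n)) (hsub : ∀ n, tsupport (f n) ⊆ Ω)
    {C : ℝ≥0∞} (hC : C ≠ ⊤) (hfC : ∀ n, energy s (f n) ≤ C)
    (h : ∀ᵐ x, Tendsto (fun n => f n x) atTop (𝓝 (u x))) : u ∈ D0 Ω s := by
  choose t ht htf hte using fun n => exists_isTestFunction_approx hΩ (hf n) (hc n) (hsub n) s
    (Nat.one_div_pos_of_nat (α := ℝ) (n := n))
  have htu : ∀ᵐ x, Tendsto (fun n => t n x) atTop (𝓝 (u x)) := by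
    filter_upwards [h] with x hx
    have h0 : Tendsto (fun n => t n x - f n x) atTop (𝓝 0) :=
      squeeze_zero_norm (fun n => htf n x) tendsto_one_div_add_atTop_nhds_zero_nat
    simpa using h0.add hx
  have htC : ∀ n, energyForm s (t n) (t n) ≤ C.toReal := fun n => by
    rw [← ((ht n).hasFiniteEnergy hN hs).toReal_energy]
    exact ENNReal.toReal_mono hC ((hte n).trans (hfC n))
  obtain ⟨g, hg, hcau⟩ := exists_convexHull_cauchy hN hs ht htC
  have hgt : ∀ n, IsTestFunction Ω (g n) := fun n => convexHull_isTestFunction ht (hg n)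
  have hgu : ∀ᵐ x, Tendsto (fun n => g n x) atTop (𝓝 (u x)) := by
    filter_upwards [htu] with x hx using tendsto_of_mem_convexHull_tail hg hx
  refine ⟨g, hgt, ?_, hgu⟩
  rw [ENNReal.tendsto_atTop_zero]
  intro ε hε
  rcases eq_or_ne ε ⊤ with rfl | hεt
  · exact ⟨0, fun _ _ => le_top⟩
  obtain ⟨n₀, hn₀⟩ := hcau ε.toReal (ENNReal.toReal_pos hε.ne' hεt)
  refine ⟨n₀, fun n hn => ?_⟩
  -- Fatou in `m` turns the Cauchy property into convergence to `u`, so completeness is not needed.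
  have h1 : energy s (g n - u) ≤ liminf (fun m => energy s (g n - g m)) atTop := by
    refine energy_le_liminf
      (fun m => ((hgt n).continuous.sub (hgt m).continuous).aemeasurable) ?_
    filter_upwards [hgu] with x hx using tendsto_const_nhds.sub hx
  refine h1.trans (liminf_le_of_frequently_le' (Eventually.frequently ?_))
  filter_upwards [eventually_ge_atTop n] with m hm
  rw [(((hgt n).hasFiniteEnergy hN hs).sub ((hgt m).hasFiniteEnergy hN hs)).energy_eq_ofReal]
  exact ENNReal.ofReal_le_of_le_toReal (hn₀ n hn m hm)

/-! ### The function space `D0` and its stability -/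

/-- The standing assumptions on the open set and the exponents. -/
structure Admissible (Ω : Set (EuclideanSpace ℝ (Fin N))) (s q : ℝ) : Prop where
  one_le : 1 ≤ N
  exponent : s ∈ Set.Ioo (0 : ℝ) 1
  one_lt : 1 < q
  lt_two : q < 2
  isOpen : IsOpen Ω
  nonempty : Ω.Nonempty
  lambdaOne_pos : 0 < lambdaOne Ω s q

lemma aemeasurable_of_mem_D0 (hu : u ∈ D0 Ω s) : AEMeasurable u := by
  obtain ⟨φ, hφ, -, h⟩ := hu
  exact aemeasurable_of_tendsto_metrizable_ae atTop
    (fun n => (hφ n).continuous.aemeasurable) h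

lemma ae_eq_zero_of_mem_D0 (hu : u ∈ D0 Ω s) : ∀ᵐ x, x ∉ Ω → u x = 0 := by
  obtain ⟨φ, hφ, -, h⟩ := hu
  filter_upwards [h] with x hx hxΩ
  refine tendsto_nhds_unique hx ?_
  have : ∀ n, φ n x = 0 := fun n =>
    image_eq_zero_of_notMem_tsupport fun hc => hxΩ ((hφ n).2.2 hc)
  simp [this]

lemma D0_congr (hu : u ∈ D0 Ω s) (h : u =ᵐ[volume] v) : v ∈ D0 Ω s := by
  obtain ⟨φ, hφ, he, hae⟩ := hu
  refine ⟨φ, hφ, ?_, ?_⟩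
  · refine he.congr fun n => energy_congr ?_
    filter_upwards [h] with x hx
    simp [hx]
  · filter_upwards [h, hae] with x hx hx'
    rwa [← hx]

lemma IsTestFunction.mem_D0 (hu : IsTestFunction Ω u) : u ∈ D0 Ω s := by
  refine ⟨fun _ => u, fun _ => hu, ?_, Eventually.of_forall fun x => tendsto_const_nhds⟩
  simp [energy]

lemma Admissible.hasFiniteEnergy (hA : Admissible Ω s q) (hu : u ∈ D0 Ω s) :
    HasFiniteEnergy s u := by
  have hm := aemeasurable_of_mem_D0 hu
  obtain ⟨φ, hφ, he, -⟩ := hu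
  obtain ⟨n, hn⟩ := (he.eventually (gt_mem_nhds ENNReal.zero_lt_top)).exists
  have h1 : HasFiniteEnergy s (φ n) := (hφ n).hasFiniteEnergy hA.one_le hA.exponent
  have h2 : HasFiniteEnergy s (φ n - u) :=
    hasFiniteEnergy_of_lt_top ((hφ n).continuous.aemeasurable.sub hm) hn
  have h3 := h1.sub h2
  rwa [sub_sub_cancel] at h3

/-- Fatou gives the lower bound and the triangle inequality in `L²` the upper one. -/
lemma Admissible.tendsto_energy (hA : Admissible Ω s q) (hu : u ∈ D0 Ω s)
    {φ : ℕ → EuclideanSpace ℝ (Fin N) → ℝ} (hφ : ∀ n, IsTestFunction Ω (φ n))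
    (he : Tendsto (fun n => energy s (φ n - u)) atTop (𝓝 0))
    (hae : ∀ᵐ x, Tendsto (fun n => φ n x) atTop (𝓝 (u x))) :
    Tendsto (fun n => energy s (φ n)) atTop (𝓝 (energy s u)) := by
  have hfe := hA.hasFiniteEnergy hu
  have hfφ : ∀ n, HasFiniteEnergy s (φ n) := fun n =>
    (hφ n).hasFiniteEnergy hA.one_le hA.exponent
  refine tendsto_of_le_liminf_of_limsup_le
    (energy_le_liminf (fun n => (hφ n).continuous.aemeasurable) hae) ?_
  have h1 : ∀ n, energy s (φ n) ≤
      (eLpNorm (diffQuot s u) 2 volume + energy s (φ n - u) ^ (1 / 2 : ℝ)) ^ 2 := by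
    intro n
    rw [energy_eq_eLpNorm, energy_eq_eLpNorm, ← ENNReal.rpow_natCast_mul]
    norm_num
    gcongr
    have : diffQuot s (φ n) = diffQuot s u + diffQuot s (φ n - u) := by
      rw [← diffQuot_add, add_sub_cancel]
    conv_lhs => rw [this]
    exact eLpNorm_add_le hfe.1 ((hfφ n).sub hfe).1 (by norm_num)
  have h2 : Tendsto (fun n => (eLpNorm (diffQuot s u) 2 volume +
      energy s (φ n - u) ^ (1 / 2 : ℝ)) ^ 2) atTop (𝓝 (energy s u)) := by
    have h3 : Tendsto (fun n => energy s (φ n - u) ^ (1 / 2 : ℝ)) atTop (𝓝 0) := by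
      have := (ENNReal.continuous_rpow_const (y := (1 / 2 : ℝ))).tendsto 0 |>.comp he
      simpa [Function.comp_def] using this
    have h4 := ENNReal.Tendsto.pow (n := 2)
      (tendsto_const_nhds (x := eLpNorm (diffQuot s u) 2 volume).add h3)
    rwa [add_zero, ← energy_eq_eLpNorm] at h4
  exact (limsup_le_limsup (Eventually.of_forall h1)).trans h2.limsup_eq.le

/-- `D^{s,2}_0(Ω)` is stable under composition with Lipschitz functions of two variables that
vanish at the origin. -/
lemma Admissible.comp_mem_D0 (hA : Admissible Ω s q) (hu : u ∈ D0 Ω s) (hv : v ∈ D0 Ω s)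
    {F : ℝ → ℝ → ℝ} {K : ℝ} (hF : ∀ a b c d, |F a b - F c d| ≤ K * (|a - c| + |b - d|))
    (h0 : F 0 0 = 0) : (fun x => F (u x) (v x)) ∈ D0 Ω s := by
  have hfu := hA.hasFiniteEnergy hu
  have hfv := hA.hasFiniteEnergy hv
  obtain ⟨φ, hφ, hφe, hφae⟩ := id hu
  obtain ⟨ψ, hψ, hψe, hψae⟩ := id hv
  have hφt := hA.tendsto_energy hu hφ hφe hφae
  have hψt := hA.tendsto_energy hv hψ hψe hψae
  have hFc : Continuous fun p : ℝ × ℝ => F p.1 p.2 := by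
    rw [continuous_iff_continuousAt]
    rintro ⟨a, b⟩
    rw [ContinuousAt, tendsto_iff_dist_tendsto_zero]
    refine squeeze_zero (fun _ => dist_nonneg)
      (g := fun p : ℝ × ℝ => K * (|p.1 - a| + |p.2 - b|)) (fun p => hF _ _ _ _) ?_
    have : Continuous fun p : ℝ × ℝ => K * (|p.1 - a| + |p.2 - b|) := by fun_prop
    simpa using this.tendsto (a, b)
  have hsupp : ∀ n, Function.support (fun x => F (φ n x) (ψ n x)) ⊆
      tsupport (φ n) ∪ tsupport (ψ n) := by
    intro n x hx
    by_contra hc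
    rw [Set.mem_union, not_or] at hc
    apply hx
    simp only [image_eq_zero_of_notMem_tsupport hc.1, image_eq_zero_of_notMem_tsupport hc.2, h0]
  have htsupp : ∀ n, tsupport (fun x => F (φ n x) (ψ n x)) ⊆
      tsupport (φ n) ∪ tsupport (ψ n) := fun n =>
    closure_minimal (hsupp n) ((isClosed_tsupport _).union (isClosed_tsupport _))
  have hle : ∀ᶠ n in atTop, energy s (φ n) + energy s (ψ n) < energy s u + energy s v + 1 := by
    refine (hφt.add hψt).eventually (gt_mem_nhds ?_)
    exact ENNReal.lt_add_right
      (ENNReal.add_lt_top.2 ⟨hfu.energy_lt_top, hfv.energy_lt_top⟩).ne one_ne_zero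
  -- The energies are bounded only from some index on, so the approximating sequences are shifted by
  -- `n₀`.
  obtain ⟨n₀, hn₀⟩ := eventually_atTop.1 hle
  refine mem_D0_of_tendsto hA.one_le hA.exponent hA.isOpen
    (f := fun n x => F (φ (n + n₀) x) (ψ (n + n₀) x))
    (C := ENNReal.ofReal (2 * K ^ 2) * (energy s u + energy s v + 1))
    (fun n => hFc.comp ((hφ _).continuous.prodMk (hψ _).continuous))
    (fun n => ?_) (fun n => ?_) ?_ (fun n => ?_) ?_
  · exact HasCompactSupport.of_support_subset_isCompact ((hφ _).2.1.isCompact.union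
      (hψ _).2.1.isCompact) (hsupp _)
  · exact (htsupp _).trans (Set.union_subset (hφ _).2.2 (hψ _).2.2)
  · refine (ENNReal.mul_lt_top ENNReal.ofReal_lt_top ?_).ne
    simp [hfu.energy_lt_top, hfv.energy_lt_top]
  · refine (energy_le_of_abs_sub_le (hφ (n + n₀)).continuous.aemeasurable
      (fun x y => hF _ _ _ _)).trans ?_
    exact mul_le_mul_right (hn₀ (n + n₀) (by omega)).le _
  · filter_upwards [hφae, hψae] with x hx hy
    exact (hFc.tendsto _).comp (((hx.comp (tendsto_add_atTop_nat n₀))).prodMk_nhds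
      (hy.comp (tendsto_add_atTop_nat n₀)))

lemma Admissible.add_smul_mem_D0 (hA : Admissible Ω s q) (hu : u ∈ D0 Ω s) (hv : v ∈ D0 Ω s)
    (t : ℝ) : u + t • v ∈ D0 Ω s := by
  refine hA.comp_mem_D0 hu hv (F := fun a b => a + t * b) (K := 1 + |t|) (fun a b c d => ?_)
    (by simp)
  have h1 : a + t * b - (c + t * d) = (a - c) + t * (b - d) := by ring
  rw [h1]
  refine (abs_add_le _ _).trans ?_
  rw [abs_mul]
  nlinarith [abs_nonneg (a - c), abs_nonneg (b - d), abs_nonneg t,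
    mul_nonneg (abs_nonneg t) (abs_nonneg (a - c))]

lemma Admissible.smul_mem_D0 (hA : Admissible Ω s q) (hu : u ∈ D0 Ω s) (c : ℝ) :
    c • u ∈ D0 Ω s := by
  refine hA.comp_mem_D0 hu hu (F := fun a _ => c * a) (K := |c|) (fun a b d e => ?_) (by simp)
  rw [← mul_sub, abs_mul]
  exact mul_le_mul_of_nonneg_left (by linarith [abs_nonneg (b - e)]) (abs_nonneg _)

lemma Admissible.abs_mem_D0 (hA : Admissible Ω s q) (hu : u ∈ D0 Ω s) :
    (fun x => |u x|) ∈ D0 Ω s := by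
  refine hA.comp_mem_D0 hu hu (F := fun a _ => |a|) (K := 1) (fun a b d e => ?_) (by simp)
  linarith [abs_abs_sub_abs_le a d, abs_nonneg (b - e)]

lemma Admissible.max_mem_D0 (hA : Admissible Ω s q) (hu : u ∈ D0 Ω s) (hv : v ∈ D0 Ω s) :
    (fun x => max (u x) (v x)) ∈ D0 Ω s := by
  refine hA.comp_mem_D0 hu hv (F := fun a b => max a b) (K := 1) (fun a b c d => ?_) (by simp)
  refine (abs_max_sub_max_le_max a b c d).trans ?_
  rw [one_mul]
  exact max_le_add_of_nonneg (abs_nonneg _) (abs_nonneg _)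

lemma Admissible.min_mem_D0 (hA : Admissible Ω s q) (hu : u ∈ D0 Ω s) (hv : v ∈ D0 Ω s) :
    (fun x => min (u x) (v x)) ∈ D0 Ω s := by
  refine hA.comp_mem_D0 hu hv (F := fun a b => min a b) (K := 1) (fun a b c d => ?_) (by simp)
  refine (abs_min_sub_min_le_max a b c d).trans ?_
  rw [one_mul]
  exact max_le_add_of_nonneg (abs_nonneg _) (abs_nonneg _)

/-! ### Finiteness of `λ₁` and the Poincaré inequality -/

lemma exists_isTestFunction_pos (hΩ : IsOpen Ω) {x : EuclideanSpace ℝ (Fin N)} (hx : x ∈ Ω) :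
    ∃ φ, IsTestFunction Ω φ ∧ (∀ y, 0 ≤ φ y) ∧ ∀ᶠ y in 𝓝 x, 0 < φ y := by
  obtain ⟨r, hr, hrΩ⟩ := Metric.nhds_basis_closedBall.mem_iff.1 (hΩ.mem_nhds hx)
  let ρ : ContDiffBump x := ⟨r / 2, r, by linarith, by linarith⟩
  refine ⟨ρ, ⟨ρ.contDiff, ρ.hasCompactSupport, ?_⟩, fun y => ρ.nonneg, ?_⟩
  · rw [ρ.tsupport_eq]
    exact hrΩ
  · filter_upwards [Metric.ball_mem_nhds x hr] with y hy using ρ.pos_of_mem_ball hy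

lemma IsTestFunction.integrable_rpow (hu : IsTestFunction Ω u) (hq : 0 < q) :
    Integrable (fun x => |u x| ^ q) := by
  refine Continuous.integrable_of_hasCompactSupport ?_ ?_
  · exact hu.continuous.abs.rpow_const fun _ => Or.inr hq.le
  · refine hu.2.1.mono fun x hx hc => hx ?_
    simp [hc, hq.ne']

lemma integral_rpow_smul (q : ℝ) (c : ℝ) (u : EuclideanSpace ℝ (Fin N) → ℝ) :
    ∫ x in Ω, |(c • u) x| ^ q = |c| ^ q * ∫ x in Ω, |u x| ^ q := by
  rw [← integral_const_mul]
  congr 1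
  ext x
  rw [Pi.smul_apply, smul_eq_mul, abs_mul, Real.mul_rpow (abs_nonneg _) (abs_nonneg _)]

lemma integral_rpow_nonneg (q : ℝ) (u : EuclideanSpace ℝ (Fin N) → ℝ) :
    0 ≤ ∫ x in Ω, |u x| ^ q :=
  integral_nonneg fun _ => Real.rpow_nonneg (abs_nonneg _) _

/-- The factor that normalises the `L^q` norm. -/
lemma integral_rpow_normalised (hq : 0 < q) (h : 0 < ∫ x in Ω, |u x| ^ q) :
    ∫ x in Ω, |(((∫ x in Ω, |u x| ^ q) ^ (-1 / q)) • u) x| ^ q = 1 := by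
  rw [integral_rpow_smul, abs_of_pos (Real.rpow_pos_of_pos h _), ← Real.rpow_mul h.le,
    div_mul_cancel₀ _ hq.ne', Real.rpow_neg_one, inv_mul_cancel₀ h.ne']

lemma lambdaOne_le (hu : IsTestFunction Ω u) (h : ∫ x in Ω, |u x| ^ q = 1) :
    lambdaOne Ω s q ≤ energy s u :=
  sInf_le ⟨u, hu, h, rfl⟩

lemma Admissible.lambdaOne_ne_top (hA : Admissible Ω s q) : lambdaOne Ω s q ≠ ⊤ := by
  obtain ⟨x, hx⟩ := hA.nonempty
  obtain ⟨φ, hφ, hφ0, hφx⟩ := exists_isTestFunction_pos hA.isOpen hx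
  have hq : 0 < q := one_pos.trans hA.one_lt
  have hm : 0 < ∫ y in Ω, |φ y| ^ q := by
    rw [setIntegral_eq_integral_of_forall_compl_eq_zero]
    · refine Continuous.integral_pos_of_hasCompactSupport_nonneg_nonzero (x := x) ?_ ?_ ?_ ?_
      · exact hφ.continuous.abs.rpow_const fun _ => Or.inr hq.le
      · refine hφ.2.1.mono fun y hy hc => hy ?_
        simp [hc, hq.ne']
      · exact fun y => Real.rpow_nonneg (abs_nonneg _) _
      · exact (Real.rpow_pos_of_pos (abs_pos.2 hφx.self_of_nhds.ne') _).ne'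
    · intro y hy
      rw [image_eq_zero_of_notMem_tsupport fun hc => hy (hφ.2.2 hc), abs_zero,
        Real.zero_rpow hq.ne']
  have hψ := hφ.smul ((∫ y in Ω, |φ y| ^ q) ^ (-1 / q))
  exact ((lambdaOne_le hψ (integral_rpow_normalised hq hm)).trans_lt
    (hψ.hasFiniteEnergy hA.one_le hA.exponent).energy_lt_top).ne

lemma Admissible.toReal_lambdaOne_pos (hA : Admissible Ω s q) : 0 < (lambdaOne Ω s q).toReal :=
  ENNReal.toReal_pos hA.lambdaOne_pos.ne' hA.lambdaOne_ne_top

/-- This is the definition of `λ₁` made scale-invariant by normalising `u`. With the energy alone on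
the right, the bound passes to limits in `D0`. -/
lemma Admissible.integral_le_of_isTestFunction (hA : Admissible Ω s q)
    (hu : IsTestFunction Ω u) :
    ∫ x in Ω, |u x| ^ q ≤ ((energy s u).toReal / (lambdaOne Ω s q).toReal) ^ (q / 2) := by
  have hq : 0 < q := one_pos.trans hA.one_lt
  have hL := hA.toReal_lambdaOne_pos
  have hfe := hu.hasFiniteEnergy hA.one_le hA.exponent
  rcases (integral_rpow_nonneg (Ω := Ω) q u).eq_or_lt with h | h
  · rw [← h]
    positivity
  set m := ∫ x in Ω, |u x| ^ q with hm
  have h1 : lambdaOne Ω s q ≤ energy s (m ^ (-1 / q) • u) :=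
    lambdaOne_le (hu.smul _) (integral_rpow_normalised hq h)
  have h2 := ENNReal.toReal_mono (hfe.smul _).energy_lt_top.ne h1
  rw [(hfe.smul _).toReal_energy, energyForm_smul_left, energyForm_smul_right,
    ← hfe.toReal_energy, ← mul_assoc, ← Real.rpow_add h] at h2
  have h3 : m ^ (2 / q) ≤ (energy s u).toReal / (lambdaOne Ω s q).toReal := by
    rw [le_div_iff₀ hL]
    have h4 := mul_le_mul_of_nonneg_left h2 (Real.rpow_nonneg h.le (2 / q))
    rw [← mul_assoc, ← Real.rpow_add h] at h4
    have : 2 / q + (-1 / q + -1 / q) = 0 := by ring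
    rwa [this, Real.rpow_zero, one_mul] at h4
  calc m = (m ^ (2 / q)) ^ (q / 2) := by
        rw [← Real.rpow_mul h.le, div_mul_div_comm, mul_comm, div_self (by positivity),
          Real.rpow_one]
    _ ≤ _ := Real.rpow_le_rpow (by positivity) h3 (by positivity)

/-- Fatou on the left and convergence of energies on the right. The lower integral is used because
integrability of `|u|^q` is a consequence, not yet available. -/
lemma Admissible.lintegral_le (hA : Admissible Ω s q) (hu : u ∈ D0 Ω s) :
    ∫⁻ x in Ω, ENNReal.ofReal (|u x| ^ q) ≤
      ENNReal.ofReal (((energy s u).toReal / (lambdaOne Ω s q).toReal) ^ (q / 2)) := by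
  have hq : 0 < q := one_pos.trans hA.one_lt
  obtain ⟨φ, hφ, hφe, hφae⟩ := id hu
  have hφt := hA.tendsto_energy hu hφ hφe hφae
  calc ∫⁻ x in Ω, ENNReal.ofReal (|u x| ^ q)
      = ∫⁻ x in Ω, liminf (fun n => ENNReal.ofReal (|φ n x| ^ q)) atTop := by
        refine lintegral_congr_ae (ae_restrict_of_ae ?_)
        filter_upwards [hφae] with x hx
        exact (Tendsto.liminf_eq (ENNReal.tendsto_ofReal
          (hx.abs.rpow_const (Or.inr hq.le)))).symm
    _ ≤ liminf (fun n => ∫⁻ x in Ω, ENNReal.ofReal (|φ n x| ^ q)) atTop :=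
        lintegral_liminf_le' fun n =>
          ((hφ n).integrable_rpow hq).integrableOn.aemeasurable.ennreal_ofReal
    _ ≤ liminf (fun n => ENNReal.ofReal
          (((energy s (φ n)).toReal / (lambdaOne Ω s q).toReal) ^ (q / 2))) atTop := by
        refine liminf_le_liminf (Eventually.of_forall fun n => ?_)
        rw [← ofReal_integral_eq_lintegral_ofReal ((hφ n).integrable_rpow hq).integrableOn
          (Eventually.of_forall fun _ => Real.rpow_nonneg (abs_nonneg _) _)]
        exact ENNReal.ofReal_le_ofReal (hA.integral_le_of_isTestFunction (hφ n))
    _ = _ := by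
        refine Tendsto.liminf_eq (ENNReal.tendsto_ofReal (Tendsto.rpow_const ?_
          (Or.inr (by positivity))))
        exact ((ENNReal.tendsto_toReal (hA.hasFiniteEnergy hu).energy_lt_top.ne).comp
          hφt).div_const _

lemma Admissible.integrableOn_rpow (hA : Admissible Ω s q) (hu : u ∈ D0 Ω s) :
    IntegrableOn (fun x => |u x| ^ q) Ω := by
  have hm : AEMeasurable (fun x => |u x| ^ q) (volume.restrict Ω) := by
    have := (aemeasurable_of_mem_D0 hu).restrict (s := Ω)
    exact this.abs.pow_const q
  refine ⟨hm.aestronglyMeasurable, ?_⟩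
  rw [hasFiniteIntegral_iff_ofReal
    (Eventually.of_forall fun _ => Real.rpow_nonneg (abs_nonneg _) _)]
  exact (hA.lintegral_le hu).trans_lt ENNReal.ofReal_lt_top

/-- The Poincaré inequality that defines the first eigenvalue, on `D^{s,2}_0(Ω)`. -/
lemma Admissible.poincare (hA : Admissible Ω s q) (hu : u ∈ D0 Ω s) :
    (lambdaOne Ω s q).toReal * (∫ x in Ω, |u x| ^ q) ^ (2 / q) ≤ energyForm s u u := by
  have hq : 0 < q := one_pos.trans hA.one_lt
  have hL := hA.toReal_lambdaOne_pos
  have h1 := hA.lintegral_le hu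
  rw [← ofReal_integral_eq_lintegral_ofReal (hA.integrableOn_rpow hu)
    (Eventually.of_forall fun _ => Real.rpow_nonneg (abs_nonneg _) _),
    ENNReal.ofReal_le_ofReal_iff (by positivity), (hA.hasFiniteEnergy hu).toReal_energy] at h1
  have h0 := energyForm_self_nonneg s u
  have h2 := Real.rpow_le_rpow (integral_rpow_nonneg q u) h1 (show 0 ≤ 2 / q by positivity)
  rw [← Real.rpow_mul (by positivity), div_mul_div_comm, mul_comm,
    div_self (by positivity), Real.rpow_one, le_div_iff₀ hL] at h2
  linarith

/-! ### Absolute values, lattice operations and their equality cases -/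

/-- A product set is null only if a factor is null. This converts pointwise equality in the double
integral into a global alternative for the function; the nonlocality of the energy replaces
connectedness of `Ω`. -/
lemma ae_not_or_ae_not_of_prod {P R : EuclideanSpace ℝ (Fin N) → Prop}
    (h : ∀ᵐ p : EuclideanSpace ℝ (Fin N) × EuclideanSpace ℝ (Fin N), ¬ (P p.1 ∧ R p.2)) :
    (∀ᵐ x, ¬ P x) ∨ ∀ᵐ x, ¬ R x := by
  have h1 : (volume : Measure (EuclideanSpace ℝ (Fin N) × EuclideanSpace ℝ (Fin N)))
      ({x | P x} ×ˢ {x | R x}) = 0 := by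
    rw [ae_iff] at h
    simp only [not_not] at h
    exact h
  rw [Measure.volume_eq_prod, Measure.prod_prod, mul_eq_zero] at h1
  simpa [ae_iff] using h1

lemma HasFiniteEnergy.integrable_sq (hu : HasFiniteEnergy s u) :
    Integrable (fun p => diffQuot s u p ^ 2) := by
  simpa only [pow_two] using hu.integrable_mul hu

lemma energyForm_self_eq_integral (s : ℝ) (u : EuclideanSpace ℝ (Fin N) → ℝ) :
    energyForm s u u = ∫ p, diffQuot s u p ^ 2 := by
  simp only [energyForm_eq_integral, pow_two]

lemma eq_zero_of_div_norm_rpow {a : ℝ} {x y : EuclideanSpace ℝ (Fin N)} {b : ℝ}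
    (hxy : x ≠ y) (h : b / ‖x - y‖ ^ a = 0) : b = 0 := by
  rcases div_eq_zero_iff.1 h with h | h
  · exact h
  · exact absurd h (Real.rpow_pos_of_pos (norm_pos_iff.2 (sub_ne_zero.2 hxy)) _).ne'

lemma diffQuot_abs_sq_le (s : ℝ) (u : EuclideanSpace ℝ (Fin N) → ℝ)
    (p : EuclideanSpace ℝ (Fin N) × EuclideanSpace ℝ (Fin N)) :
    diffQuot s (fun x => |u x|) p ^ 2 ≤ diffQuot s u p ^ 2 := by
  rw [diffQuot_sq, diffQuot_sq]
  gcongr ?_ / _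
  exact sq_le_sq.2 (abs_abs_sub_abs_le (u p.1) (u p.2))

lemma energy_abs_le (s : ℝ) (u : EuclideanSpace ℝ (Fin N) → ℝ) :
    energy s (fun x => |u x|) ≤ energy s u := by
  rw [energy_eq_lintegral, energy_eq_lintegral]
  exact lintegral_mono fun p => ENNReal.ofReal_le_ofReal (diffQuot_abs_sq_le s u p)

/-- If taking absolute values does not decrease the energy, then the function has a sign. -/
lemma ae_nonneg_or_ae_nonpos_of_energyForm_abs (hu : HasFiniteEnergy s u)
    (hu' : HasFiniteEnergy s fun x => |u x|)
    (h : energyForm s u u ≤ energyForm s (fun x => |u x|) fun x => |u x|) :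
    (∀ᵐ x, u x ≤ 0) ∨ ∀ᵐ x, 0 ≤ u x := by
  rw [energyForm_self_eq_integral, energyForm_self_eq_integral] at h
  have hnn : ∀ p, 0 ≤ diffQuot s u p ^ 2 - diffQuot s (fun x => |u x|) p ^ 2 := fun p =>
    sub_nonneg.2 (diffQuot_abs_sq_le s u p)
  have h0 : ∫ p, (diffQuot s u p ^ 2 - diffQuot s (fun x => |u x|) p ^ 2) = 0 := by
    refine le_antisymm ?_ (integral_nonneg hnn)
    rw [integral_sub hu.integrable_sq hu'.integrable_sq]
    linarith
  rw [integral_eq_zero_iff_of_nonneg hnn (hu.integrable_sq.sub hu'.integrable_sq)] at h0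
  have h1 : ∀ᵐ p : EuclideanSpace ℝ (Fin N) × EuclideanSpace ℝ (Fin N),
      ¬ (0 < u p.1 ∧ u p.2 < 0) := by
    filter_upwards [h0] with p hp hc
    have hne : p.1 ≠ p.2 := fun he => by
      rw [he] at hc
      exact lt_asymm hc.1 hc.2
    simp only [Pi.zero_apply] at hp
    rw [diffQuot_sq, diffQuot_sq, ← sub_div] at hp
    have := eq_zero_of_div_norm_rpow hne hp
    rw [abs_of_pos hc.1, abs_of_neg hc.2] at this
    nlinarith [mul_pos hc.1 (neg_pos.2 hc.2)]
  simpa using ae_not_or_ae_not_of_prod (P := fun x => 0 < u x) (R := fun x => u x < 0) h1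

/-- The defect in the lattice inequality is explicit: it pairs the positive part of `u - v` at one
point with its negative part at the other. Both the inequality and its equality case are read off
from it. -/
lemma sq_max_add_sq_min (a b c d : ℝ) :
    (max a c - max b d) ^ 2 + (min a c - min b d) ^ 2 +
      2 * (max (a - c) 0 * max (d - b) 0 + max (c - a) 0 * max (b - d) 0) =
      (a - b) ^ 2 + (c - d) ^ 2 := by
  rcases le_total a c with h1 | h1 <;> rcases le_total b d with h2 | h2 <;>
    simp only [max_eq_left, max_eq_right, min_eq_left, min_eq_right, h1, h2, sub_nonneg.2 h1,
      sub_nonneg.2 h2, sub_nonpos.2 h1, sub_nonpos.2 h2] <;> ring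

lemma diffQuot_max_sq_add_min_sq_le (s : ℝ) (u v : EuclideanSpace ℝ (Fin N) → ℝ)
    (p : EuclideanSpace ℝ (Fin N) × EuclideanSpace ℝ (Fin N)) :
    diffQuot s (fun x => max (u x) (v x)) p ^ 2 + diffQuot s (fun x => min (u x) (v x)) p ^ 2 ≤
      diffQuot s u p ^ 2 + diffQuot s v p ^ 2 := by
  simp only [diffQuot_sq, ← add_div]
  gcongr ?_ / _
  rw [← sq_max_add_sq_min (u p.1) (u p.2) (v p.1) (v p.2)]
  have : 0 ≤ max (u p.1 - v p.1) 0 * max (v p.2 - u p.2) 0 +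
    max (v p.1 - u p.1) 0 * max (u p.2 - v p.2) 0 := by positivity
  linarith

lemma energyForm_max_add_min_le (hu : HasFiniteEnergy s u) (hv : HasFiniteEnergy s v)
    (hM : HasFiniteEnergy s fun x => max (u x) (v x))
    (hm : HasFiniteEnergy s fun x => min (u x) (v x)) :
    energyForm s (fun x => max (u x) (v x)) (fun x => max (u x) (v x)) +
      energyForm s (fun x => min (u x) (v x)) (fun x => min (u x) (v x)) ≤
      energyForm s u u + energyForm s v v := by
  simp only [energyForm_self_eq_integral]
  rw [← integral_add hM.integrable_sq hm.integrable_sq,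
    ← integral_add hu.integrable_sq hv.integrable_sq]
  exact integral_mono (hM.integrable_sq.add hm.integrable_sq)
    (hu.integrable_sq.add hv.integrable_sq) (diffQuot_max_sq_add_min_sq_le s u v)

/-- In the equality case of the lattice inequality for the energy the functions are ordered. -/
lemma ae_le_or_ae_le_of_energyForm_max_add_min (hu : HasFiniteEnergy s u)
    (hv : HasFiniteEnergy s v)
    (hM : HasFiniteEnergy s fun x => max (u x) (v x))
    (hm : HasFiniteEnergy s fun x => min (u x) (v x))
    (h : energyForm s u u + energyForm s v v ≤
      energyForm s (fun x => max (u x) (v x)) (fun x => max (u x) (v x)) +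
        energyForm s (fun x => min (u x) (v x)) (fun x => min (u x) (v x))) :
    (∀ᵐ x, u x ≤ v x) ∨ ∀ᵐ x, v x ≤ u x := by
  simp only [energyForm_self_eq_integral] at h
  rw [← integral_add hM.integrable_sq hm.integrable_sq,
    ← integral_add hu.integrable_sq hv.integrable_sq] at h
  have hnn : ∀ p, 0 ≤ (diffQuot s u p ^ 2 + diffQuot s v p ^ 2) -
      (diffQuot s (fun x => max (u x) (v x)) p ^ 2 +
        diffQuot s (fun x => min (u x) (v x)) p ^ 2) := fun p =>
    sub_nonneg.2 (diffQuot_max_sq_add_min_sq_le s u v p)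
  have hI1 : Integrable fun p => diffQuot s u p ^ 2 + diffQuot s v p ^ 2 :=
    hu.integrable_sq.add hv.integrable_sq
  have hI2 : Integrable fun p => diffQuot s (fun x => max (u x) (v x)) p ^ 2 +
      diffQuot s (fun x => min (u x) (v x)) p ^ 2 := hM.integrable_sq.add hm.integrable_sq
  have h0 : ∫ p, ((diffQuot s u p ^ 2 + diffQuot s v p ^ 2) -
      (diffQuot s (fun x => max (u x) (v x)) p ^ 2 +
        diffQuot s (fun x => min (u x) (v x)) p ^ 2)) = 0 := by
    refine le_antisymm ?_ (integral_nonneg hnn)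
    rw [integral_sub hI1 hI2]
    exact sub_nonpos.2 h
  rw [integral_eq_zero_iff_of_nonneg hnn (hI1.sub hI2)] at h0
  have h1 : ∀ᵐ p : EuclideanSpace ℝ (Fin N) × EuclideanSpace ℝ (Fin N),
      ¬ (v p.1 < u p.1 ∧ u p.2 < v p.2) := by
    filter_upwards [h0] with p hp hc
    have hne : p.1 ≠ p.2 := fun he => by
      rw [he] at hc
      exact lt_asymm hc.1 hc.2
    simp only [Pi.zero_apply] at hp
    simp only [diffQuot_sq, ← add_div, ← sub_div] at hp
    have := eq_zero_of_div_norm_rpow hne hp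
    rw [← sq_max_add_sq_min (u p.1) (u p.2) (v p.1) (v p.2), add_sub_cancel_left,
      max_eq_left (sub_nonneg.2 hc.1.le), max_eq_left (sub_nonneg.2 hc.2.le)] at this
    nlinarith [mul_pos (sub_pos.2 hc.1) (sub_pos.2 hc.2),
      mul_nonneg (le_max_right (v p.1 - u p.1) 0) (le_max_right (u p.2 - v p.2) 0)]
  simpa using ae_not_or_ae_not_of_prod (P := fun x => v x < u x) (R := fun x => u x < v x) h1

/-! ### Convexity of `t^(2/q)` and existence of a minimiser -/

lemma two_le_rpow_add_rpow {r A B : ℝ} (hr : 1 ≤ r) (hA : 0 ≤ A) (hB : 0 ≤ B)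
    (hAB : A + B = 2) : 2 ≤ A ^ r + B ^ r := by
  have h := (convexOn_rpow hr).2 hA hB (show (0 : ℝ) ≤ 1 / 2 by norm_num)
    (show (0 : ℝ) ≤ 1 / 2 by norm_num) (by norm_num)
  simp only [smul_eq_mul] at h
  rw [← mul_add, hAB] at h
  norm_num at h
  linarith

/-- Quantitative strict convexity by compactness: on the pairs with gap at least `η` the continuous
function `A^r + (2-A)^r` attains its minimum, which exceeds `2`. The excess is `ε`. -/
lemma exists_abs_sub_le_of_rpow_add_rpow_le {r : ℝ} (hr : 1 < r) {η : ℝ} (hη : 0 < η) :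
    ∃ ε > 0, ∀ A B : ℝ, 0 ≤ A → 0 ≤ B → A + B = 2 → A ^ r + B ^ r < 2 + ε → |A - B| < η := by
  set S : Set ℝ := {A | η ≤ |A - (2 - A)|} ∩ Set.Icc 0 2 with hS
  have hSc : IsCompact S := isCompact_Icc.inter_left
    (isClosed_le continuous_const (by fun_prop))
  have hmem : ∀ A B : ℝ, 0 ≤ A → 0 ≤ B → A + B = 2 → η ≤ |A - B| → A ∈ S := by
    intro A B hA hB hAB h
    have : B = 2 - A := by linarith
    rw [this] at h
    exact ⟨h, hA, by linarith⟩
  rcases S.eq_empty_or_nonempty with hne | hne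
  · refine ⟨1, one_pos, fun A B hA hB hAB _ => ?_⟩
    by_contra hc
    have := hmem A B hA hB hAB (not_lt.1 hc)
    simp [hne] at this
  · have hcont : Continuous fun A : ℝ => A ^ r + (2 - A) ^ r := by
      have h0 : 0 ≤ r := by linarith
      exact (Real.continuous_rpow_const h0).add
        ((Real.continuous_rpow_const h0).comp (continuous_const.sub continuous_id))
    obtain ⟨A₀, hA₀, hmin⟩ := hSc.exists_isMinOn hne hcont.continuousOn
    have hlt : 2 < A₀ ^ r + (2 - A₀) ^ r := by
      have hneq : A₀ ≠ 2 - A₀ := fun he => by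
        have h1 : η ≤ |A₀ - (2 - A₀)| := hA₀.1
        rw [sub_eq_zero.2 he, abs_zero] at h1
        linarith
      have h := (strictConvexOn_rpow hr).2 (show A₀ ∈ Set.Ici 0 from hA₀.2.1)
        (show 2 - A₀ ∈ Set.Ici 0 from sub_nonneg.2 hA₀.2.2) hneq
        (show (0 : ℝ) < 1 / 2 by norm_num) (show (0 : ℝ) < 1 / 2 by norm_num) (by norm_num)
      simp only [smul_eq_mul] at h
      rw [← mul_add, add_sub_cancel] at h
      norm_num at h
      linarith
    refine ⟨A₀ ^ r + (2 - A₀) ^ r - 2, by linarith, fun A B hA hB hAB h => ?_⟩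
    by_contra hc
    have h1 := hmin (hmem A B hA hB hAB (not_lt.1 hc))
    have h2 : B = 2 - A := by linarith
    simp only [Set.mem_ofPred_eq] at h1
    rw [h2] at h
    linarith

lemma rpow_max_add_rpow_min {a b : ℝ} (q : ℝ) : max a b ^ q + min a b ^ q = a ^ q + b ^ q := by
  rcases le_total a b with h | h <;> simp [h, add_comm]

lemma abs_rpow_max_sub_rpow_min {a b : ℝ} (ha : 0 ≤ a) (hb : 0 ≤ b) (hq : 0 ≤ q) :
    max a b ^ q - min a b ^ q = |a ^ q - b ^ q| := by
  rcases le_total a b with h | h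
  · rw [max_eq_right h, min_eq_left h, abs_sub_comm,
      abs_of_nonneg (sub_nonneg.2 (Real.rpow_le_rpow ha h hq))]
  · rw [max_eq_left h, min_eq_right h,
      abs_of_nonneg (sub_nonneg.2 (Real.rpow_le_rpow hb h hq))]

lemma Admissible.integral_max_add_integral_min (hA : Admissible Ω s q) (hu : u ∈ D0 Ω s)
    (hv : v ∈ D0 Ω s) (hu0 : ∀ x, 0 ≤ u x) (hv0 : ∀ x, 0 ≤ v x) :
    (∫ x in Ω, |max (u x) (v x)| ^ q) + ∫ x in Ω, |min (u x) (v x)| ^ q =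
      (∫ x in Ω, |u x| ^ q) + ∫ x in Ω, |v x| ^ q := by
  rw [← integral_add (hA.integrableOn_rpow (hA.max_mem_D0 hu hv))
      (hA.integrableOn_rpow (hA.min_mem_D0 hu hv)),
    ← integral_add (hA.integrableOn_rpow hu) (hA.integrableOn_rpow hv)]
  refine integral_congr_ae (Eventually.of_forall fun x => ?_)
  simp only [abs_of_nonneg (hu0 x), abs_of_nonneg (hv0 x),
    abs_of_nonneg (le_max_of_le_left (hu0 x)), abs_of_nonneg (le_min (hu0 x) (hv0 x))]
  exact rpow_max_add_rpow_min q

/-- Two non-negative normalised functions with almost minimal energy are close in `L^q`. -/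
lemma Admissible.exists_integral_abs_sub_lt (hA : Admissible Ω s q) {η : ℝ} (hη : 0 < η) :
    ∃ δ > 0, ∀ u ∈ D0 Ω s, ∀ v ∈ D0 Ω s, (∀ x, 0 ≤ u x) → (∀ x, 0 ≤ v x) →
      ∫ x in Ω, |u x| ^ q = 1 → ∫ x in Ω, |v x| ^ q = 1 →
      energyForm s u u < (lambdaOne Ω s q).toReal + δ →
      energyForm s v v < (lambdaOne Ω s q).toReal + δ →
      ∫ x in Ω, |(|u x| ^ q - |v x| ^ q)| < η := by
  have hq : 0 < q := one_pos.trans hA.one_lt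
  have hL := hA.toReal_lambdaOne_pos
  have hr : 1 < 2 / q := by rw [lt_div_iff₀ hq]; linarith [hA.lt_two]
  obtain ⟨ε, hε, h⟩ := exists_abs_sub_le_of_rpow_add_rpow_le hr hη
  set L := (lambdaOne Ω s q).toReal
  -- Two energies, each less than `δ` above `L`, exceed `2L` by less than `2δ = Lε`; division by `L`
  -- leaves `ε`.
  refine ⟨L * ε / 2, by positivity, fun u hu v hv hu0 hv0 hu1 hv1 hue hve => ?_⟩
  have hM := hA.max_mem_D0 hu hv
  have hm := hA.min_mem_D0 hu hv
  have hsum := hA.integral_max_add_integral_min hu hv hu0 hv0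
  rw [hu1, hv1] at hsum
  have hlat := energyForm_max_add_min_le (hA.hasFiniteEnergy hu) (hA.hasFiniteEnergy hv)
    (hA.hasFiniteEnergy hM) (hA.hasFiniteEnergy hm)
  have hPM := hA.poincare hM
  have hPm := hA.poincare hm
  have hlt : (∫ x in Ω, |max (u x) (v x)| ^ q) ^ (2 / q) +
      (∫ x in Ω, |min (u x) (v x)| ^ q) ^ (2 / q) < 2 + ε := by
    refine lt_of_mul_lt_mul_left ?_ hL.le
    rw [mul_add, mul_add]
    linarith
  have hfin := h _ _ (integral_rpow_nonneg q fun x => max (u x) (v x))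
    (integral_rpow_nonneg q fun x => min (u x) (v x)) (by linarith) hlt
  -- The gap `A - B` is exactly `∫ |u^q - v^q|`, since `max^q - min^q = |u^q - v^q|` pointwise.
  rw [← integral_sub (hA.integrableOn_rpow hM) (hA.integrableOn_rpow hm)] at hfin
  refine lt_of_eq_of_lt ?_ ((le_abs_self _).trans_lt hfin)
  refine integral_congr_ae (Eventually.of_forall fun x => ?_)
  simp only [abs_of_nonneg (hu0 x), abs_of_nonneg (hv0 x),
    abs_of_nonneg (le_max_of_le_left (hu0 x)), abs_of_nonneg (le_min (hu0 x) (hv0 x))]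
  exact (abs_rpow_max_sub_rpow_min (hu0 x) (hv0 x) hq.le).symm

lemma Admissible.exists_minimising_seq (hA : Admissible Ω s q) :
    ∃ φ : ℕ → EuclideanSpace ℝ (Fin N) → ℝ, (∀ n, IsTestFunction Ω (φ n)) ∧
      (∀ n, ∫ x in Ω, |φ n x| ^ q = 1) ∧
      ∀ n : ℕ, energy s (φ n) < lambdaOne Ω s q + ENNReal.ofReal (1 / ((n : ℝ) + 1)) := by
  have hex : ∀ n : ℕ, ∃ φ : EuclideanSpace ℝ (Fin N) → ℝ, IsTestFunction Ω φ ∧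
      ∫ x in Ω, |φ x| ^ q = 1 ∧
      energy s φ < lambdaOne Ω s q + ENNReal.ofReal (1 / ((n : ℝ) + 1)) := by
    intro n
    have hlt : lambdaOne Ω s q < lambdaOne Ω s q + ENNReal.ofReal (1 / ((n : ℝ) + 1)) :=
      ENNReal.lt_add_right hA.lambdaOne_ne_top
        (ENNReal.ofReal_pos.2 Nat.one_div_pos_of_nat).ne'
    obtain ⟨_, ⟨φ, hφ, h1, rfl⟩, h⟩ := sInf_lt_iff.1 hlt
    exact ⟨φ, hφ, h1, h⟩
  choose φ h1 h2 h3 using hex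
  exact ⟨φ, h1, h2, h3⟩

lemma Admissible.isMinimiser_iff (hA : Admissible Ω s q) (hu : u ∈ D0 Ω s) :
    IsMinimiser Ω s q u ↔ ∫ x in Ω, |u x| ^ q = 1 ∧
      energyForm s u u = (lambdaOne Ω s q).toReal := by
  have hfe := hA.hasFiniteEnergy hu
  rw [← hfe.toReal_energy, ENNReal.toReal_eq_toReal_iff' hfe.energy_lt_top.ne hA.lambdaOne_ne_top]
  exact ⟨fun h => ⟨h.1.2, h.2⟩, fun h => ⟨⟨hu, h.1⟩, h.2⟩⟩

lemma Admissible.lambdaOne_le_energy (hA : Admissible Ω s q) (hu : u ∈ constraintSet Ω s q) :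
    lambdaOne Ω s q ≤ energy s u := by
  have h := hA.poincare hu.1
  rw [hu.2, Real.one_rpow, mul_one, ← (hA.hasFiniteEnergy hu.1).toReal_energy] at h
  exact (ENNReal.toReal_le_toReal hA.lambdaOne_ne_top
    (hA.hasFiniteEnergy hu.1).energy_lt_top.ne).1 h

/-- The first eigenvalue is attained. -/
lemma Admissible.exists_isMinimiser (hA : Admissible Ω s q) : ∃ u, IsMinimiser Ω s q u := by
  have hq : 0 < q := one_pos.trans hA.one_lt
  obtain ⟨φ, hφ, hφ1, hφe⟩ := hA.exists_minimising_seq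
  have hψD : ∀ n, (fun x => |φ n x|) ∈ D0 Ω s := fun n => hA.abs_mem_D0 (hφ n).mem_D0
  have hψe : ∀ n : ℕ, energy s (fun x => |φ n x|) <
      lambdaOne Ω s q + ENNReal.ofReal (1 / ((n : ℝ) + 1)) := fun n =>
    (energy_abs_le s (φ n)).trans_lt (hφe n)
  have hψr : ∀ n : ℕ, energyForm s (fun x => |φ n x|) (fun x => |φ n x|) <
      (lambdaOne Ω s q).toReal + 1 / ((n : ℝ) + 1) := by
    intro n
    rw [← (hA.hasFiniteEnergy (hψD n)).toReal_energy]
    have := (ENNReal.toReal_lt_toReal (hA.hasFiniteEnergy (hψD n)).energy_lt_top.ne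
      (ENNReal.add_lt_top.2 ⟨hA.lambdaOne_ne_top.lt_top, ENNReal.ofReal_lt_top⟩).ne).2 (hψe n)
    rwa [ENNReal.toReal_add hA.lambdaOne_ne_top ENNReal.ofReal_ne_top,
      ENNReal.toReal_ofReal Nat.one_div_pos_of_nat.le] at this
  have hintg : ∀ n, Integrable (fun x => |φ n x| ^ q) (volume.restrict Ω) := fun n =>
    ((hφ n).integrable_rpow hq).integrableOn
  -- Convergence is sought for the `q`-th powers in `L¹`, where the lattice estimate gives the
  -- Cauchy property directly and the normalisation passes to the limit.
  set F : ℕ → (EuclideanSpace ℝ (Fin N) →₁[volume.restrict Ω] ℝ) := fun n => (hintg n).toL1 _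
  have hcau : CauchySeq F := by
    rw [Metric.cauchySeq_iff]
    intro η hη
    obtain ⟨δ, hδ, hclose⟩ := hA.exists_integral_abs_sub_lt hη
    obtain ⟨n₀, hn₀⟩ := exists_nat_one_div_lt hδ
    refine ⟨n₀, fun m hm n hn => ?_⟩
    rw [dist_eq_norm, ← Integrable.toL1_sub _ _ (hintg m) (hintg n),
      L1.norm_of_fun_eq_integral_norm]
    have hb : ∀ k ≥ n₀, energyForm s (fun x => |φ k x|) (fun x => |φ k x|) <
        (lambdaOne Ω s q).toReal + δ := fun k hk =>
      (hψr k).trans (by linarith [Nat.one_div_le_one_div (α := ℝ) hk])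
    have := hclose _ (hψD m) _ (hψD n) (fun x => abs_nonneg _) (fun x => abs_nonneg _)
      (by simpa using hφ1 m) (by simpa using hφ1 n) (hb m hm) (hb n hn)
    simpa using this
  obtain ⟨G, hG⟩ := cauchySeq_tendsto_of_complete hcau
  have hGint : ∫ x in Ω, G x = 1 := by
    have h1 := (continuous_integral.tendsto G).comp hG
    have h2 : ((fun f : EuclideanSpace ℝ (Fin N) →₁[volume.restrict Ω] ℝ => ∫ x in Ω, f x) ∘ F) =
        fun _ => 1 := by
      ext n
      simp only [Function.comp_apply]
      rw [integral_congr_ae (hintg n).coeFn_toL1, hφ1 n]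
    rw [h2] at h1
    exact tendsto_nhds_unique h1 tendsto_const_nhds
  obtain ⟨k, hk, hkae⟩ := (tendstoInMeasure_of_tendsto_Lp hG).exists_seq_tendsto_ae
  have hlim : ∀ᵐ x ∂volume.restrict Ω, Tendsto (fun n => |φ (k n) x| ^ q) atTop (𝓝 (G x)) := by
    filter_upwards [hkae, ae_all_iff.2 fun n => (hintg n).coeFn_toL1] with x hx hx'
    exact hx.congr fun n => hx' (k n)
  have hG0 : ∀ᵐ x ∂volume.restrict Ω, 0 ≤ G x := by
    filter_upwards [hlim] with x hx
    exact ge_of_tendsto' hx fun n => Real.rpow_nonneg (abs_nonneg _) _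
  -- `G` is determined only on `Ω`; the test functions vanish outside, so extension by zero gives
  -- a.e. convergence on the whole space.
  set u : EuclideanSpace ℝ (Fin N) → ℝ := Ω.indicator fun x => G x ^ (1 / q) with hu
  have hψu : ∀ᵐ x, Tendsto (fun n => |φ (k n) x|) atTop (𝓝 (u x)) := by
    filter_upwards [(ae_restrict_iff' hA.isOpen.measurableSet).1 hlim] with x hx
    by_cases hxΩ : x ∈ Ω
    · have h1 := (hx hxΩ).rpow_const (p := 1 / q) (Or.inr (by positivity))
      rw [hu, Set.indicator_of_mem hxΩ]
      refine h1.congr fun n => ?_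
      rw [← Real.rpow_mul (abs_nonneg _), mul_one_div_cancel hq.ne', Real.rpow_one]
    · have : ∀ n, φ (k n) x = 0 := fun n =>
        image_eq_zero_of_notMem_tsupport fun hc => hxΩ ((hφ _).2.2 hc)
      simp [hu, hxΩ, this]
  have hu1 : ∫ x in Ω, |u x| ^ q = 1 := by
    rw [← hGint]
    refine integral_congr_ae ?_
    filter_upwards [hG0, ae_restrict_mem hA.isOpen.measurableSet] with x hx hxΩ
    rw [hu, Set.indicator_of_mem hxΩ, abs_of_nonneg (Real.rpow_nonneg hx _),
      ← Real.rpow_mul hx, one_div_mul_cancel hq.ne', Real.rpow_one]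
  have hbound : ∀ n, energy s (fun x => |φ (k n) x|) ≤ lambdaOne Ω s q + 1 := by
    intro n
    refine (hψe _).le.trans (add_le_add_right ?_ _)
    rw [← ENNReal.ofReal_one]
    refine ENNReal.ofReal_le_ofReal ?_
    rw [div_le_one (by positivity)]
    linarith [Nat.cast_nonneg (α := ℝ) (k n)]
  have hsupp : ∀ n, tsupport (fun x => |φ n x|) ⊆ tsupport (φ n) := fun n =>
    closure_mono fun x hx hc => hx (by simp [hc])
  have huD : u ∈ D0 Ω s := by
    refine mem_D0_of_tendsto hA.one_le hA.exponent hA.isOpen (f := fun n x => |φ (k n) x|)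
      (C := lambdaOne Ω s q + 1) (fun n => (hφ _).continuous.abs)
      (fun n => (hφ _).2.1.mono' (subset_closure.trans (hsupp _)))
      (fun n => (hsupp _).trans (hφ _).2.2) ?_ hbound hψu
    exact (ENNReal.add_lt_top.2 ⟨hA.lambdaOne_ne_top.lt_top, ENNReal.one_lt_top⟩).ne
  refine ⟨u, ⟨huD, hu1⟩, le_antisymm ?_ (hA.lambdaOne_le_energy ⟨huD, hu1⟩)⟩
  refine (energy_le_liminf (fun n => (hφ _).continuous.abs.aemeasurable) hψu).trans ?_
  have hto : Tendsto (fun n => lambdaOne Ω s q + ENNReal.ofReal (1 / ((k n : ℝ) + 1))) atTop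
      (𝓝 (lambdaOne Ω s q)) := by
    have h1 : Tendsto (fun n => (1 / ((k n : ℝ) + 1))) atTop (𝓝 0) :=
      tendsto_one_div_add_atTop_nhds_zero_nat.comp hk.tendsto_atTop
    have h2 := ENNReal.tendsto_ofReal h1
    rw [ENNReal.ofReal_zero] at h2
    simpa using tendsto_const_nhds (x := lambdaOne Ω s q).add h2
  rw [← hto.liminf_eq]
  exact liminf_le_liminf (Eventually.of_forall fun n => (hψe _).le)

/-! ### Minimisers are eigenfunctions -/

lemma abs_rpow_sub_two_mul_self (q a : ℝ) (hq : 1 < q) :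
    |(|a| ^ (q - 2) * a)| = |a| ^ (q - 1) := by
  rcases eq_or_ne a 0 with rfl | ha
  · simp [Real.zero_rpow (sub_pos.2 hq).ne']
  · rw [abs_mul, abs_of_nonneg (Real.rpow_nonneg (abs_nonneg _) _)]
    nth_rewrite 2 [← Real.rpow_one |a|]
    rw [← Real.rpow_add (abs_pos.2 ha)]
    congr 1
    ring

/-- A pointwise substitute for Hölder's inequality: it yields integrability of the right-hand side
of the equation and the domination for differentiating under the integral. -/
lemma abs_rpow_sub_two_mul_mul_le {q a b : ℝ} (hq : 1 < q) :
    |(|a| ^ (q - 2) * a * b)| ≤ (|a| + |b|) ^ q := by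
  rw [abs_mul, abs_rpow_sub_two_mul_self q a hq]
  rcases eq_or_lt_of_le (add_nonneg (abs_nonneg a) (abs_nonneg b)) with h | h
  · have hb : |b| = 0 := by linarith [abs_nonneg a, abs_nonneg b]
    rw [← h, hb, mul_zero, Real.zero_rpow (by linarith)]
  · calc |a| ^ (q - 1) * |b| ≤ (|a| + |b|) ^ (q - 1) * (|a| + |b|) := by
          gcongr
          · linarith [abs_nonneg b]
          · linarith [abs_nonneg a]
      _ = (|a| + |b|) ^ q := by
          nth_rewrite 2 [← Real.rpow_one (|a| + |b|)]
          rw [← Real.rpow_add h]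
          congr 1
          ring

lemma integrableOn_abs_add_abs_rpow (hq : 1 < q) (hum : AEMeasurable u) (hvm : AEMeasurable v)
    (hu : IntegrableOn (fun x => |u x| ^ q) Ω) (hv : IntegrableOn (fun x => |v x| ^ q) Ω) :
    IntegrableOn (fun x => (|u x| + |v x|) ^ q) Ω := by
  refine Integrable.mono' ((hu.add hv).const_mul (2 ^ (q - 1)))
    (((hum.abs.add hvm.abs).pow_const q).restrict.aestronglyMeasurable)
    (Eventually.of_forall fun x => ?_)
  rw [Real.norm_eq_abs, abs_of_nonneg (by positivity)]
  exact_mod_cast NNReal.rpow_add_le_mul_rpow_add_rpow ⟨|u x|, abs_nonneg _⟩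
    ⟨|v x|, abs_nonneg _⟩ hq.le

lemma integrableOn_rpow_sub_two_mul_mul (hq : 1 < q) (hum : AEMeasurable u)
    (hvm : AEMeasurable v) (hu : IntegrableOn (fun x => |u x| ^ q) Ω)
    (hv : IntegrableOn (fun x => |v x| ^ q) Ω) :
    IntegrableOn (fun x => |u x| ^ (q - 2) * u x * v x) Ω :=
  Integrable.mono' (integrableOn_abs_add_abs_rpow hq hum hvm hu hv)
    ((((hum.abs.pow_const _).mul hum).mul hvm).restrict.aestronglyMeasurable)
    (Eventually.of_forall fun _ => abs_rpow_sub_two_mul_mul_le hq)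

/-- For `|t| < 1` one has `|u + tv| + |v| ≤ |u| + 2|v|`, whence the dominating function. -/
lemma hasDerivAt_integral_rpow (hq : 1 < q) (hum : AEMeasurable u)
    (hvm : AEMeasurable v) (hu : IntegrableOn (fun x => |u x| ^ q) Ω)
    (hv : IntegrableOn (fun x => |v x| ^ q) Ω) :
    HasDerivAt (fun t : ℝ => ∫ x in Ω, |u x + t * v x| ^ q)
      (q * ∫ x in Ω, |u x| ^ (q - 2) * u x * v x) 0 := by
  have h := hasDerivAt_integral_of_dominated_loc_of_deriv_le (μ := volume.restrict Ω)
    (F := fun (t : ℝ) x => |u x + t * v x| ^ q) (x₀ := 0)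
    (F' := fun (t : ℝ) x => q * (|u x + t * v x| ^ (q - 2) * (u x + t * v x) * v x))
    (bound := fun x => q * (|u x| + 2 * |v x|) ^ q) (s := Metric.ball 0 1)
    (Metric.ball_mem_nhds 0 one_pos)
    (Eventually.of_forall fun t =>
      ((hum.add (hvm.const_mul t)).abs.pow_const q).restrict.aestronglyMeasurable)
    (by simpa [IntegrableOn] using hu)
    (by simpa using
      (((((hum.abs.pow_const (q - 2)).mul hum).mul hvm).const_mul q).restrict
        (s := Ω)).aestronglyMeasurable) ?_ ?_ ?_
  · have h2 := h.2
    simp only [zero_mul, add_zero] at h2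
    rwa [integral_const_mul] at h2
  · refine Eventually.of_forall fun x t ht => ?_
    rw [Real.norm_eq_abs, abs_mul, abs_of_pos (one_pos.trans hq)]
    gcongr
    refine (abs_rpow_sub_two_mul_mul_le hq).trans (Real.rpow_le_rpow (by positivity) ?_
      (by linarith))
    have h1 : |u x + t * v x| ≤ |u x| + |t| * |v x| := by
      rw [← abs_mul]
      exact abs_add_le _ _
    have ht1 : |t| ≤ 1 := by
      rw [mem_ball_zero_iff, Real.norm_eq_abs] at ht
      exact ht.le
    nlinarith [abs_nonneg (v x), mul_le_mul_of_nonneg_right ht1 (abs_nonneg (v x))]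
  · have hv2 : IntegrableOn (fun x => |2 * v x| ^ q) Ω := by
      simpa [abs_mul, Real.mul_rpow, IntegrableOn] using hv.const_mul (2 ^ q)
    have := (integrableOn_abs_add_abs_rpow hq hum (hvm.const_mul 2) hu hv2).const_mul q
    simpa [abs_mul] using this
  · refine Eventually.of_forall fun x t _ => ?_
    have h1 : HasDerivAt (fun t : ℝ => u x + t * v x) (v x) t := by
      simpa using ((hasDerivAt_id t).mul_const (v x)).const_add (u x)
    have h2 := (hasDerivAt_abs_rpow (u x + t * v x) hq).comp t h1
    refine h2.congr_deriv ?_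
    ring

/-- The Euler-Lagrange equation of a minimiser. -/
lemma IsMinimiser.energyForm_eq (hA : Admissible Ω s q) (hu : IsMinimiser Ω s q u)
    (hv : v ∈ D0 Ω s) :
    energyForm s u v = (lambdaOne Ω s q).toReal * ∫ x in Ω, |u x| ^ (q - 2) * u x * v x := by
  have hq : 0 < q := one_pos.trans hA.one_lt
  have huD := hu.1.1
  have hfu := hA.hasFiniteEnergy huD
  have hfv := hA.hasFiniteEnergy hv
  have huE := ((hA.isMinimiser_iff huD).1 hu).2
  set L := (lambdaOne Ω s q).toReal
  have hG := hasDerivAt_integral_rpow hA.one_lt (aemeasurable_of_mem_D0 huD)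
    (aemeasurable_of_mem_D0 hv) (hA.integrableOn_rpow huD) (hA.integrableOn_rpow hv)
  set D := ∫ x in Ω, |u x| ^ (q - 2) * u x * v x
  have hQ : ∀ t : ℝ, energyForm s (u + t • v) (u + t • v) =
      L + 2 * t * energyForm s u v + t ^ 2 * energyForm s v v := by
    intro t
    rw [hfu.energyForm_add_self (hfv.smul t), energyForm_smul_left, energyForm_smul_right,
      energyForm_smul_right, huE]
    ring
  have h0 : ∫ x in Ω, |u x + 0 * v x| ^ q = 1 := by simpa using hu.1.2
  have hGr := (hG.rpow_const (p := 2 / q) (Or.inl (by rw [h0]; exact one_ne_zero)))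
  rw [h0, Real.one_rpow, mul_one] at hGr
  have hpoly : HasDerivAt (fun t : ℝ => L + 2 * t * energyForm s u v + t ^ 2 * energyForm s v v)
      (2 * energyForm s u v) 0 := by
    have h1 := (((hasDerivAt_id (0 : ℝ)).const_mul 2).mul_const (energyForm s u v)).const_add L
    have h2 := ((hasDerivAt_id (0 : ℝ)).pow 2).mul_const (energyForm s v v)
    exact (h1.add h2).congr_deriv (by simp)
  have hh := hpoly.sub (hGr.const_mul L)
  -- Poincaré makes this difference nonnegative for all `t`, and it vanishes at `t = 0`. Working
  -- with the homogeneous form avoids a constraint and a Lagrange multiplier.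
  have hmin : IsLocalMin (fun t : ℝ => (L + 2 * t * energyForm s u v + t ^ 2 * energyForm s v v) -
      L * (∫ x in Ω, |u x + t * v x| ^ q) ^ (2 / q)) 0 := by
    refine Eventually.of_forall fun t => ?_
    simp only [h0, Real.one_rpow]
    have := hA.poincare (hA.add_smul_mem_D0 huD hv t)
    rw [hQ t] at this
    simp only [Pi.add_apply, Pi.smul_apply, smul_eq_mul] at this
    linarith
  have hzero := hmin.hasDerivAt_eq_zero hh
  have : q * D * (2 / q) = 2 * D := by field_simp
  rw [this] at hzero
  linarith

lemma IsMinimiser.isEigenfunction (hA : Admissible Ω s q) (hu : IsMinimiser Ω s q u) :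
    IsEigenfunction Ω s q (lambdaOne Ω s q).toReal u where
  pos := hA.toReal_lambdaOne_pos
  mem := hu.1.1
  integrableOn := hA.integrableOn_rpow hu.1.1
  nontrivial h := by
    have h1 : ∫ x in Ω, |u x| ^ q = 0 := by
      refine integral_eq_zero_of_ae (ae_restrict_of_ae ?_)
      filter_upwards [h] with x hx
      simp [hx, (one_pos.trans hA.one_lt).ne']
    rw [hu.1.2] at h1
    exact one_ne_zero h1
  weak φ hφ := by
    rw [hu.energyForm_eq hA hφ, hu.1.2]
    simp

lemma abs_rpow_sub_two_mul_self_mul_self {q : ℝ} (a : ℝ) (hq : 1 < q) :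
    |a| ^ (q - 2) * a * a = |a| ^ q := by
  rcases eq_or_ne a 0 with rfl | ha
  · simp [Real.zero_rpow (one_pos.trans hq).ne']
  · rw [mul_assoc, ← pow_two, ← sq_abs, ← Real.rpow_two, ← Real.rpow_add (abs_pos.2 ha)]
    congr 1
    ring

lemma IsEigenfunction.integral_pos (hA : Admissible Ω s q) {lam : ℝ}
    (hu : IsEigenfunction Ω s q lam u) : 0 < ∫ x in Ω, |u x| ^ q := by
  refine lt_of_le_of_ne (integral_rpow_nonneg q u) fun h => hu.nontrivial ?_
  have h1 := (integral_eq_zero_iff_of_nonneg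
    (fun _ => Real.rpow_nonneg (abs_nonneg _) _) hu.integrableOn).1 h.symm
  filter_upwards [(ae_restrict_iff' hA.isOpen.measurableSet).1 h1,
    ae_eq_zero_of_mem_D0 hu.mem] with x hx hx'
  by_cases hxΩ : x ∈ Ω
  · simpa using (Real.rpow_eq_zero (abs_nonneg _) (one_pos.trans hA.one_lt).ne').1 (hx hxΩ)
  · exact hx' hxΩ

/-- The factor `‖u‖^(2-q)` makes the right-hand side homogeneous of degree one. -/
lemma IsEigenfunction.smul (hA : Admissible Ω s q) {lam : ℝ}
    (hu : IsEigenfunction Ω s q lam u) {c : ℝ} (hc : c ≠ 0) :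
    IsEigenfunction Ω s q lam (c • u) where
  pos := hu.pos
  mem := hA.smul_mem_D0 hu.mem c
  integrableOn := hA.integrableOn_rpow (hA.smul_mem_D0 hu.mem c)
  nontrivial h := hu.nontrivial <| by
    filter_upwards [h] with x hx
    simpa [hc] using hx
  weak φ hφ := by
    have hq : 0 < q := one_pos.trans hA.one_lt
    have hm := integral_rpow_nonneg (Ω := Ω) q u
    have h1 : ∀ x, |(c • u) x| ^ (q - 2) * (c • u) x * φ x =
        |c| ^ (q - 2) * c * (|u x| ^ (q - 2) * u x * φ x) := fun x => by
      rw [Pi.smul_apply, smul_eq_mul, abs_mul, Real.mul_rpow (abs_nonneg _) (abs_nonneg _)]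
      ring
    simp only [h1]
    rw [energyForm_smul_left, hu.weak φ hφ, integral_rpow_smul, integral_const_mul,
      Real.mul_rpow (by positivity) hm, ← Real.rpow_mul (abs_nonneg c),
      mul_one_div_cancel hq.ne', Real.rpow_one, Real.mul_rpow (abs_nonneg c) (by positivity)]
    have h2 : |c| ^ (2 - q) * |c| ^ (q - 2) = 1 := by
      rw [← Real.rpow_add (abs_pos.2 hc)]
      simp
    linear_combination (-(c * (lam * ((∫ x in Ω, |u x| ^ q) ^ (1 / q)) ^ (2 - q) *
      ∫ x in Ω, |u x| ^ (q - 2) * u x * φ x))) * h2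

lemma IsEigenfunction.energyForm_self (hA : Admissible Ω s q) {lam : ℝ}
    (hu : IsEigenfunction Ω s q lam u) (h1 : ∫ x in Ω, |u x| ^ q = 1) :
    energyForm s u u = lam := by
  rw [hu.weak u hu.mem]
  simp only [abs_rpow_sub_two_mul_self_mul_self _ hA.one_lt, h1]
  simp

lemma IsEigenfunction.exists_normalised (hA : Admissible Ω s q) {lam : ℝ}
    (hu : IsEigenfunction Ω s q lam u) :
    ∃ c : ℝ, 0 < c ∧ ∫ x in Ω, |(c • u) x| ^ q = 1 ∧ IsEigenfunction Ω s q lam (c • u) := by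
  have hpos := hu.integral_pos hA
  have hc := Real.rpow_pos_of_pos hpos (-1 / q)
  exact ⟨_, hc, integral_rpow_normalised (one_pos.trans hA.one_lt) hpos, hu.smul hA hc.ne'⟩

/-- The eigenvalue is the energy of the normalised eigenfunction, as seen by testing the equation
with it. -/
lemma IsEigenfunction.lambdaOne_le (hA : Admissible Ω s q) {lam : ℝ}
    (hu : IsEigenfunction Ω s q lam u) : (lambdaOne Ω s q).toReal ≤ lam := by
  obtain ⟨c, -, h1, hcu⟩ := hu.exists_normalised hA
  have h := hA.poincare hcu.mem
  rwa [h1, Real.one_rpow, mul_one, hcu.energyForm_self hA h1] at h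

lemma Admissible.isEigenfunction_iff (hA : Admissible Ω s q) :
    IsEigenfunction Ω s q (lambdaOne Ω s q).toReal u ↔
      ∃ c : ℝ, c ≠ 0 ∧ IsMinimiser Ω s q (c • u) := by
  constructor
  · intro hu
    obtain ⟨c, hc, h1, hcu⟩ := hu.exists_normalised hA
    exact ⟨c, hc.ne', (hA.isMinimiser_iff hcu.mem).2 ⟨h1, hcu.energyForm_self hA h1⟩⟩
  · rintro ⟨c, hc, hcu⟩
    have := (hcu.isEigenfunction hA).smul hA (inv_ne_zero hc)
    rwa [smul_smul, inv_mul_cancel₀ hc, one_smul] at this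

/-! ### Sign and uniqueness of minimisers -/

/-- Each point of `Ω` has a neighbourhood on which some bump is positive, and a locally null set is
null. -/
lemma ae_restrict_of_forall_isTestFunction (hΩ : IsOpen Ω)
    {P : EuclideanSpace ℝ (Fin N) → Prop}
    (h : ∀ φ, IsTestFunction Ω φ → (∀ x, 0 ≤ φ x) →
      ∀ᵐ x ∂volume.restrict Ω, 0 < φ x → P x) :
    ∀ᵐ x ∂volume.restrict Ω, P x := by
  rw [ae_restrict_iff' hΩ.measurableSet, ae_iff]
  refine measure_null_of_locally_null _ fun x hx => ?_
  have hxΩ : x ∈ Ω := by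
    by_contra hc
    exact hx fun h => absurd h hc
  obtain ⟨φ, hφ, hφ0, hφx⟩ := exists_isTestFunction_pos hΩ hxΩ
  have h1 := h φ hφ hφ0
  rw [ae_restrict_iff' hΩ.measurableSet, ae_iff] at h1
  refine ⟨_, inter_mem_nhdsWithin _ hφx, measure_mono_null ?_ h1⟩
  rintro y ⟨hy1, hy2⟩ hy3
  exact hy1 fun hyΩ => hy3 hyΩ hy2

/-- Bernoulli's inequality for `1 + tb/a`, scaled by `a^q`. -/
lemma rpow_add_mul_le {a b t q : ℝ} (ha : 0 < a) (hb : 0 ≤ b) (ht : 0 ≤ t) (hq : 1 ≤ q) :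
    a ^ q + q * t * (a ^ (q - 2) * a * b) ≤ (a + t * b) ^ q := by
  have h1 : -1 ≤ t * b / a := by
    have : 0 ≤ t * b / a := by positivity
    linarith
  have h2 := one_add_mul_self_le_rpow_one_add h1 hq
  have h3 : a + t * b = a * (1 + t * b / a) := by field_simp
  rw [h3, Real.mul_rpow ha.le (by linarith)]
  refine le_trans (le_of_eq ?_) (mul_le_mul_of_nonneg_left h2 (Real.rpow_nonneg ha.le q))
  rw [Real.rpow_sub ha, Real.rpow_two]
  field_simp

/-- Non-negative minimisers are positive: as `q < 2`, the gain of order `t ^ q` on the zero set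
beats the quadratic cost of the perturbation. -/
lemma IsMinimiser.ae_pos (hA : Admissible Ω s q) (hu : IsMinimiser Ω s q u)
    (hu0 : ∀ x, 0 ≤ u x) : ∀ᵐ x ∂volume.restrict Ω, 0 < u x := by
  have hq : 0 < q := one_pos.trans hA.one_lt
  have hr : 1 ≤ 2 / q := by rw [le_div_iff₀ hq]; linarith [hA.lt_two]
  refine ae_restrict_of_forall_isTestFunction hA.isOpen fun φ hφ hφ0 => ?_
  have huD := hu.1.1
  have hφD : φ ∈ D0 Ω s := hφ.mem_D0
  have hum := aemeasurable_of_mem_D0 huD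
  have hφm := aemeasurable_of_mem_D0 hφD
  have hfu := hA.hasFiniteEnergy huD
  have hfφ := hA.hasFiniteEnergy hφD
  have hiu := hA.integrableOn_rpow huD
  have hiφ := hA.integrableOn_rpow hφD
  have hEL := hu.energyForm_eq hA hφD
  have huE := ((hA.isMinimiser_iff huD).1 hu).2
  have hiA := integrableOn_rpow_sub_two_mul_mul hA.one_lt hum hφm hiu hiφ
  have hL := hA.toReal_lambdaOne_pos
  set L := (lambdaOne Ω s q).toReal
  set A := ∫ x in Ω, |u x| ^ (q - 2) * u x * φ x
  set J : EuclideanSpace ℝ (Fin N) → ℝ := {x | u x = 0}.indicator fun x => |φ x| ^ q with hJ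
  have hJ0 : ∀ x, 0 ≤ J x := Set.indicator_nonneg fun x _ => Real.rpow_nonneg (abs_nonneg _) _
  have hiJ : Integrable J (volume.restrict Ω) := by
    refine Integrable.indicator₀ hiφ ?_
    exact (hum.restrict (s := Ω)).nullMeasurableSet_preimage (measurableSet_singleton (0 : ℝ))
  set B := ∫ x in Ω, J x
  have hA0 : 0 ≤ A := integral_nonneg fun x =>
    mul_nonneg (mul_nonneg (Real.rpow_nonneg (abs_nonneg _) _) (hu0 x)) (hφ0 x)
  have hB0 : 0 ≤ B := integral_nonneg hJ0
  -- Poincaré for `u + tφ`: by the Euler–Lagrange equation the terms linear in `t` cancel, leaving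
  -- the gain `t^q B` from the zero set against the cost `t² E(φ)`. As `q < 2`, letting `t → 0`
  -- forces `B = 0`.
  have key : ∀ t : ℝ, 0 < t → L * (2 / q) * B ≤ t ^ (2 - q) * energyForm s φ φ := by
    intro t ht
    have hG : 1 + (q * t * A + t ^ q * B) ≤ ∫ x in Ω, |(u + t • φ) x| ^ q := by
      have hI2 : Integrable (fun x => |u x| ^ q + q * t * (|u x| ^ (q - 2) * u x * φ x))
        (volume.restrict Ω) := hiu.add (hiA.const_mul _)
      have e1 : 1 + (q * t * A + t ^ q * B) = ∫ x in Ω,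
          (|u x| ^ q + q * t * (|u x| ^ (q - 2) * u x * φ x) + t ^ q * J x) := by
        rw [integral_add hI2 (hiJ.const_mul _), integral_add hiu (hiA.const_mul _),
          integral_const_mul, integral_const_mul, hu.1.2]
        ring
      rw [e1]
      refine integral_mono (hI2.add (hiJ.const_mul _))
        (hA.integrableOn_rpow (hA.add_smul_mem_D0 huD hφD t)) fun x => ?_
      simp only [Pi.add_apply, Pi.smul_apply, smul_eq_mul]
      have hnn : 0 ≤ u x + t * φ x := add_nonneg (hu0 x) (mul_nonneg ht.le (hφ0 x))
      rw [abs_of_nonneg hnn, abs_of_nonneg (hu0 x)]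
      rcases (hu0 x).eq_or_lt with hx | hx
      · have : J x = |φ x| ^ q := Set.indicator_of_mem (s := {x | u x = 0}) hx.symm _
        rw [this, ← hx, Real.zero_rpow hq.ne', abs_of_nonneg (hφ0 x), zero_add, mul_zero,
          zero_mul, mul_zero, zero_add, zero_add, Real.mul_rpow ht.le (hφ0 x)]
      · have : J x = 0 := Set.indicator_of_notMem (s := {x | u x = 0}) hx.ne' _
        rw [this, mul_zero, add_zero]
        exact rpow_add_mul_le hx (hφ0 x) ht.le hA.one_lt.le
    have hx0 : 0 ≤ q * t * A + t ^ q * B := by positivity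
    -- Bernoulli again, now with exponent `2/q ≥ 1`.
    have hGr : 1 + 2 / q * (q * t * A + t ^ q * B) ≤
        (∫ x in Ω, |(u + t • φ) x| ^ q) ^ (2 / q) :=
      (one_add_mul_self_le_rpow_one_add (by linarith) hr).trans
        (Real.rpow_le_rpow (by positivity) hG (by positivity))
    have hP := hA.poincare (hA.add_smul_mem_D0 huD hφD t)
    rw [hfu.energyForm_add_self (hfφ.smul t), energyForm_smul_left, energyForm_smul_right,
      energyForm_smul_right, huE, hEL] at hP
    have h1 := (mul_le_mul_of_nonneg_left hGr hL.le).trans hP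
    have e2 : 2 / q * (q * t * A + t ^ q * B) = 2 * t * A + 2 / q * t ^ q * B := by
      field_simp
    rw [e2] at h1
    have h2 : t ^ q * (L * (2 / q) * B) ≤ t ^ 2 * energyForm s φ φ := by nlinarith
    have htq : 0 < t ^ q := Real.rpow_pos_of_pos ht q
    have e3 : t ^ 2 = t ^ q * t ^ (2 - q) := by
      rw [← Real.rpow_add ht, add_sub_cancel, Real.rpow_two]
    rw [e3, mul_assoc (t ^ q) (t ^ (2 - q))] at h2
    exact le_of_mul_le_mul_left h2 htq
  have hlim : Tendsto (fun t : ℝ => t ^ (2 - q) * energyForm s φ φ) (𝓝[>] 0) (𝓝 0) := by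
    have h0 : 0 < 2 - q := by linarith [hA.lt_two]
    have := ((Real.continuous_rpow_const h0.le).tendsto 0).mul_const (energyForm s φ φ)
    rw [Real.zero_rpow h0.ne', zero_mul] at this
    exact this.mono_left nhdsWithin_le_nhds
  have hBle : L * (2 / q) * B ≤ 0 :=
    ge_of_tendsto hlim (eventually_mem_nhdsWithin.mono fun t ht => key t ht)
  have hBz : B = 0 := by
    have : 0 < L * (2 / q) := by positivity
    nlinarith
  have hJz := (integral_eq_zero_iff_of_nonneg hJ0 hiJ).1 hBz
  filter_upwards [hJz] with x hx hφx
  refine lt_of_le_of_ne (hu0 x) fun hc => ?_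
  have h1 : J x = |φ x| ^ q := Set.indicator_of_mem (s := {x | u x = 0}) hc.symm _
  rw [h1] at hx
  exact (Real.rpow_pos_of_pos (abs_pos.2 hφx.ne') q).ne' hx

lemma IsMinimiser.abs (hA : Admissible Ω s q) (hu : IsMinimiser Ω s q u) :
    IsMinimiser Ω s q fun x => |u x| := by
  have h1 : (fun x => |u x|) ∈ constraintSet Ω s q :=
    ⟨hA.abs_mem_D0 hu.1.1, by simpa using hu.1.2⟩
  exact ⟨h1, le_antisymm ((energy_abs_le s u).trans hu.2.le) (hA.lambdaOne_le_energy h1)⟩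

lemma IsMinimiser.ae_nonpos_or_ae_nonneg (hA : Admissible Ω s q) (hu : IsMinimiser Ω s q u) :
    (∀ᵐ x, u x ≤ 0) ∨ ∀ᵐ x, 0 ≤ u x := by
  have h := hu.abs hA
  refine ae_nonneg_or_ae_nonpos_of_energyForm_abs (hA.hasFiniteEnergy hu.1.1)
    (hA.hasFiniteEnergy h.1.1) ?_
  rw [((hA.isMinimiser_iff hu.1.1).1 hu).2, ((hA.isMinimiser_iff h.1.1).1 h).2]

lemma IsMinimiser.ae_pos_or_ae_neg (hA : Admissible Ω s q) (hu : IsMinimiser Ω s q u) :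
    (∀ᵐ x ∂volume.restrict Ω, 0 < u x) ∨ ∀ᵐ x ∂volume.restrict Ω, u x < 0 := by
  have hpos := (hu.abs hA).ae_pos hA fun x => abs_nonneg _
  rcases hu.ae_nonpos_or_ae_nonneg hA with h | h
  · right
    filter_upwards [hpos, ae_restrict_of_ae h] with x hx hx'
    exact lt_of_le_of_ne hx' (abs_pos.1 hx)
  · left
    filter_upwards [hpos, ae_restrict_of_ae h] with x hx hx'
    exact lt_of_le_of_ne hx' (abs_pos.1 hx).symm

lemma Admissible.ae_eq_of_ae_le (hA : Admissible Ω s q) (hu : u ∈ D0 Ω s) (hv : v ∈ D0 Ω s)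
    (hu0 : ∀ x, 0 ≤ u x) (hv0 : ∀ x, 0 ≤ v x)
    (h : ∫ x in Ω, |u x| ^ q = ∫ x in Ω, |v x| ^ q) (hle : ∀ᵐ x, u x ≤ v x) :
    u =ᵐ[volume] v := by
  have hq : 0 < q := one_pos.trans hA.one_lt
  have hle' : (fun x => |u x| ^ q) ≤ᵐ[volume.restrict Ω] fun x => |v x| ^ q := by
    filter_upwards [ae_restrict_of_ae hle] with x hx
    rw [abs_of_nonneg (hu0 x), abs_of_nonneg (hv0 x)]
    exact Real.rpow_le_rpow (hu0 x) hx hq.le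
  have heq := (integral_eq_iff_of_ae_le (hA.integrableOn_rpow hu) (hA.integrableOn_rpow hv)
    hle').1 h
  filter_upwards [(ae_restrict_iff' hA.isOpen.measurableSet).1 heq, ae_eq_zero_of_mem_D0 hu,
    ae_eq_zero_of_mem_D0 hv] with x hx hxu hxv
  by_cases hxΩ : x ∈ Ω
  · have := hx hxΩ
    rw [abs_of_nonneg (hu0 x), abs_of_nonneg (hv0 x)] at this
    exact (Real.rpow_left_inj (hu0 x) (hv0 x) hq.ne').1 this
  · rw [hxu hxΩ, hxv hxΩ]

/-- The chain `2L ≤ L (A^(2/q) + B^(2/q)) ≤ E(max) + E(min) ≤ E(u) + E(v) = 2L` collapses to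
equalities, so the minimisers are ordered; equal norms then identify them. -/
lemma IsMinimiser.ae_eq_of_nonneg (hA : Admissible Ω s q) (hu : IsMinimiser Ω s q u)
    (hv : IsMinimiser Ω s q v) (hu0 : ∀ x, 0 ≤ u x) (hv0 : ∀ x, 0 ≤ v x) :
    u =ᵐ[volume] v := by
  have hq : 0 < q := one_pos.trans hA.one_lt
  have hr : 1 ≤ 2 / q := by rw [le_div_iff₀ hq]; linarith [hA.lt_two]
  have hM := hA.max_mem_D0 hu.1.1 hv.1.1
  have hm := hA.min_mem_D0 hu.1.1 hv.1.1
  have hsum := hA.integral_max_add_integral_min hu.1.1 hv.1.1 hu0 hv0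
  rw [hu.1.2, hv.1.2] at hsum
  have h2 := two_le_rpow_add_rpow hr (integral_rpow_nonneg q fun x => max (u x) (v x))
    (integral_rpow_nonneg q fun x => min (u x) (v x)) (by linarith)
  have hPM := hA.poincare hM
  have hPm := hA.poincare hm
  have h3 := mul_le_mul_of_nonneg_left h2 hA.toReal_lambdaOne_pos.le
  rcases ae_le_or_ae_le_of_energyForm_max_add_min (hA.hasFiniteEnergy hu.1.1)
    (hA.hasFiniteEnergy hv.1.1) (hA.hasFiniteEnergy hM) (hA.hasFiniteEnergy hm) (by
      rw [((hA.isMinimiser_iff hu.1.1).1 hu).2, ((hA.isMinimiser_iff hv.1.1).1 hv).2]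
      linarith) with h | h
  · exact hA.ae_eq_of_ae_le hu.1.1 hv.1.1 hu0 hv0 (hu.1.2.trans hv.1.2.symm) h
  · exact (hA.ae_eq_of_ae_le hv.1.1 hu.1.1 hv0 hu0 (hv.1.2.trans hu.1.2.symm) h).symm

lemma IsMinimiser.exists_ae_eq_smul (hA : Admissible Ω s q) (hu : IsMinimiser Ω s q u)
    (hv : IsMinimiser Ω s q v) : ∃ c : ℝ, c ≠ 0 ∧ v =ᵐ[volume] c • u := by
  have habs := (hu.abs hA).ae_eq_of_nonneg hA (hv.abs hA) (fun _ => abs_nonneg _)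
    fun _ => abs_nonneg _
  rcases hu.ae_nonpos_or_ae_nonneg hA with h | h <;>
    rcases hv.ae_nonpos_or_ae_nonneg hA with h' | h'
  · refine ⟨1, one_ne_zero, ?_⟩
    filter_upwards [habs, h, h'] with x hx hux hvx
    rw [abs_of_nonpos hux, abs_of_nonpos hvx] at hx
    simp only [Pi.smul_apply, smul_eq_mul]
    linarith
  · refine ⟨-1, by norm_num, ?_⟩
    filter_upwards [habs, h, h'] with x hx hux hvx
    rw [abs_of_nonpos hux, abs_of_nonneg hvx] at hx
    simp only [Pi.smul_apply, smul_eq_mul]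
    linarith
  · refine ⟨-1, by norm_num, ?_⟩
    filter_upwards [habs, h, h'] with x hx hux hvx
    rw [abs_of_nonneg hux, abs_of_nonpos hvx] at hx
    simp only [Pi.smul_apply, smul_eq_mul]
    linarith
  · refine ⟨1, one_ne_zero, ?_⟩
    filter_upwards [habs, h, h'] with x hx hux hvx
    rw [abs_of_nonneg hux, abs_of_nonneg hvx] at hx
    simp only [Pi.smul_apply, smul_eq_mul]
    linarith

lemma IsEigenfunction.exists_ae_eq_smul (hA : Admissible Ω s q)
    (hu : IsEigenfunction Ω s q (lambdaOne Ω s q).toReal u)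
    (hv : IsEigenfunction Ω s q (lambdaOne Ω s q).toReal v) :
    ∃ c : ℝ, c ≠ 0 ∧ v =ᵐ[volume] c • u := by
  obtain ⟨a, ha, hau⟩ := hA.isEigenfunction_iff.1 hu
  obtain ⟨b, hb, hbv⟩ := hA.isEigenfunction_iff.1 hv
  obtain ⟨c, hc, h⟩ := hau.exists_ae_eq_smul hA hbv
  refine ⟨b⁻¹ * (c * a), mul_ne_zero (inv_ne_zero hb) (mul_ne_zero hc ha), ?_⟩
  filter_upwards [h] with x hx
  simp only [Pi.smul_apply, smul_eq_mul] at hx ⊢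
  field_simp
  linarith

lemma IsEigenfunction.ae_pos_or_ae_neg (hA : Admissible Ω s q)
    (hu : IsEigenfunction Ω s q (lambdaOne Ω s q).toReal u) :
    (∀ᵐ x ∂volume.restrict Ω, 0 < u x) ∨ ∀ᵐ x ∂volume.restrict Ω, u x < 0 := by
  obtain ⟨c, hc, h1, hcu⟩ := hu.exists_normalised hA
  have hmin := (hA.isMinimiser_iff hcu.mem).2 ⟨h1, hcu.energyForm_self hA h1⟩
  refine (hmin.ae_pos_or_ae_neg hA).imp (fun h => ?_) fun h => ?_
  · filter_upwards [h] with x hx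
    exact pos_of_mul_pos_right (a := c) hx hc.le
  · filter_upwards [h] with x hx
    exact neg_of_mul_neg_right (a := c) hx hc.le

/-! ### Eigenfunctions of constant sign -/

lemma IsEigenfunction.congr (hA : Admissible Ω s q) (hu : IsEigenfunction Ω s q lam u)
    (h : u =ᵐ[volume] v) : IsEigenfunction Ω s q lam v where
  pos := hu.pos
  mem := D0_congr hu.mem h
  integrableOn := hA.integrableOn_rpow (D0_congr hu.mem h)
  nontrivial hv := hu.nontrivial (h.trans hv)
  weak ψ hψ := by
    rw [← energyForm_congr h (ae_eq_refl ψ), hu.weak ψ hψ]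
    have h' : ∀ᵐ x ∂volume.restrict Ω, u x = v x := ae_restrict_of_ae h
    congr 1
    · congr 3
      refine integral_congr_ae ?_
      filter_upwards [h'] with x hx
      rw [hx]
    · refine integral_congr_ae ?_
      filter_upwards [h'] with x hx
      rw [hx]

/-- Truncating at `M` makes `φ²/(|u|+ε)` a globally Lipschitz function of `(φ, u)`. With `M` a bound
for `|φ|` the truncation is inactive, so the quotient lies in `D0` even for unbounded `u`. -/
lemma abs_min_sq_div_sub_le {M ε : ℝ} (hM : 0 ≤ M) (hε : 0 < ε) (a b c d : ℝ) :
    |min |a| M ^ 2 / (|b| + ε) - min |c| M ^ 2 / (|d| + ε)| ≤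
      (2 * M / ε + M ^ 2 / ε ^ 2) * (|a - c| + |b - d|) := by
  set A := min |a| M
  set C := min |c| M
  set B := |b| + ε
  set D := |d| + ε
  have hA0 : 0 ≤ A := le_min (abs_nonneg _) hM
  have hC0 : 0 ≤ C := le_min (abs_nonneg _) hM
  have hAM : A ≤ M := min_le_right _ _
  have hCM : C ≤ M := min_le_right _ _
  have hB : ε ≤ B := le_add_of_nonneg_left (abs_nonneg _)
  have hD : ε ≤ D := le_add_of_nonneg_left (abs_nonneg _)
  have hB0 : 0 < B := hε.trans_le hB
  have hD0 : 0 < D := hε.trans_le hD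
  have hAC : |A - C| ≤ |a - c| := by
    refine (abs_min_sub_min_le_max |a| M |c| M).trans ?_
    rw [sub_self, abs_zero]
    exact max_le (abs_abs_sub_abs_le a c) (abs_nonneg _)
  have hBD : |D - B| ≤ |b - d| := by
    have : D - B = |d| - |b| := by simp only [B, D]; ring
    rw [this, abs_sub_comm b d]
    exact abs_abs_sub_abs_le d b
  have e : A ^ 2 / B - C ^ 2 / D = (A + C) * (A - C) / D + A ^ 2 * (D - B) / (B * D) := by
    field_simp
    ring
  have h1 : |(A + C) * (A - C) / D| ≤ 2 * M / ε * |a - c| := by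
    rw [abs_div, abs_mul, abs_of_nonneg (add_nonneg hA0 hC0), abs_of_pos hD0, div_mul_eq_mul_div]
    gcongr
    linarith
  have h2 : |A ^ 2 * (D - B) / (B * D)| ≤ M ^ 2 / ε ^ 2 * |b - d| := by
    rw [abs_div, abs_mul, abs_of_nonneg (sq_nonneg A), abs_of_pos (mul_pos hB0 hD0),
      div_mul_eq_mul_div, pow_two ε]
    gcongr
  rw [e]
  refine (abs_add_le _ _).trans ((add_le_add h1 h2).trans ?_)
  have h3 : 0 ≤ 2 * M / ε * |b - d| := by positivity
  have h4 : 0 ≤ M ^ 2 / ε ^ 2 * |a - c| := by positivity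
  linarith

lemma Admissible.sq_div_mem_D0 (hA : Admissible Ω s q) (hu : u ∈ D0 Ω s)
    (hφ : IsTestFunction Ω φ) {ε : ℝ} (hε : 0 < ε) :
    (fun x => φ x ^ 2 / (|u x| + ε)) ∈ D0 Ω s := by
  obtain ⟨M, hM⟩ := hφ.2.1.exists_bound_of_continuous hφ.continuous
  have hM0 : 0 ≤ M := (norm_nonneg _).trans (hM 0)
  have h := hA.comp_mem_D0 (hφ.mem_D0 (s := s)) hu
    (F := fun a b => min |a| M ^ 2 / (|b| + ε)) (abs_min_sq_div_sub_le hM0 hε)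
    (by simp [hM0])
  refine D0_congr h (Eventually.of_forall fun x => ?_)
  simp only
  rw [min_eq_left (show |φ x| ≤ M from hM x), sq_abs]

/-- The remainder is kept exactly, not merely as nonnegative: its blow-up where `u` vanishes drives
the minimum principle. -/
lemma picone_identity {a b c d : ℝ} (ha : 0 < a) (hb : 0 < b) :
    (c - d) ^ 2 - (a - b) * (c ^ 2 / a - d ^ 2 / b) = (a * d - b * c) ^ 2 / (a * b) := by
  field_simp
  ring

/-- The remainder in Picone's inequality for the test function `φ² / (u + ε)`. -/
lemma diffQuot_sq_sub_eq (hu0 : ∀ x, 0 ≤ u x) {ε : ℝ} (hε : 0 < ε)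
    (p : EuclideanSpace ℝ (Fin N) × EuclideanSpace ℝ (Fin N)) :
    diffQuot s φ p ^ 2 - diffQuot s u p * diffQuot s (fun x => φ x ^ 2 / (|u x| + ε)) p =
      ((u p.1 + ε) * φ p.2 - (u p.2 + ε) * φ p.1) ^ 2 / ((u p.1 + ε) * (u p.2 + ε)) /
        ‖p.1 - p.2‖ ^ ((N : ℝ) + 2 * s) := by
  rw [diffQuot_sq, diffQuot_mul, ← sub_div,
    ← picone_identity (add_pos_of_nonneg_of_pos (hu0 p.1) hε)
      (add_pos_of_nonneg_of_pos (hu0 p.2) hε), abs_of_nonneg (hu0 p.1), abs_of_nonneg (hu0 p.2),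
    add_sub_add_right_eq_sub]

lemma diffQuot_sq_sub_nonneg (hu0 : ∀ x, 0 ≤ u x) {ε : ℝ} (hε : 0 < ε)
    (p : EuclideanSpace ℝ (Fin N) × EuclideanSpace ℝ (Fin N)) :
    0 ≤ diffQuot s φ p ^ 2 - diffQuot s u p *
      diffQuot s (fun x => φ x ^ 2 / (|u x| + ε)) p := by
  rw [diffQuot_sq_sub_eq hu0 hε]
  have h1 := add_pos_of_nonneg_of_pos (hu0 p.1) hε
  have h2 := add_pos_of_nonneg_of_pos (hu0 p.2) hε
  positivity

lemma IsEigenfunction.picone (hA : Admissible Ω s q) (hu : IsEigenfunction Ω s q lam u)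
    (h1 : ∫ x in Ω, |u x| ^ q = 1) (hφ : IsTestFunction Ω φ) {ε : ℝ} (hε : 0 < ε) :
    (∫ p, (diffQuot s φ p ^ 2 - diffQuot s u p *
        diffQuot s (fun x => φ x ^ 2 / (|u x| + ε)) p)) +
      lam * (∫ x in Ω, |u x| ^ (q - 2) * u x * (φ x ^ 2 / (|u x| + ε))) =
      energyForm s φ φ := by
  have hψ := hA.sq_div_mem_D0 hu.mem hφ hε
  have hw := hu.weak _ hψ
  rw [h1, Real.one_rpow, Real.one_rpow, mul_one] at hw
  rw [← hw, energyForm_self_eq_integral, energyForm_eq_integral, integral_sub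
    (hφ.hasFiniteEnergy hA.one_le hA.exponent).integrable_sq
    ((hA.hasFiniteEnergy hu.mem).integrable_mul (hA.hasFiniteEnergy hψ)), sub_add_cancel]

lemma rpow_sub_two_mul_mul_sq_div_nonneg {ε : ℝ} (hu0 : ∀ x, 0 ≤ u x) (hε : 0 < ε)
    (x : EuclideanSpace ℝ (Fin N)) :
    0 ≤ |u x| ^ (q - 2) * u x * (φ x ^ 2 / (|u x| + ε)) := by
  have := hu0 x
  positivity

/-- The bound does not depend on `ε`, because the term carrying the eigenvalue is nonnegative and
can be dropped. -/
lemma IsEigenfunction.lintegral_picone_le (hA : Admissible Ω s q)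
    (hu : IsEigenfunction Ω s q lam u) (h1 : ∫ x in Ω, |u x| ^ q = 1) (hu0 : ∀ x, 0 ≤ u x)
    (hφ : IsTestFunction Ω φ) {ε : ℝ} (hε : 0 < ε) :
    ∫⁻ p, ENNReal.ofReal (diffQuot s φ p ^ 2 - diffQuot s u p *
      diffQuot s (fun x => φ x ^ 2 / (|u x| + ε)) p) ≤ ENNReal.ofReal (energyForm s φ φ) := by
  have hψ := hA.sq_div_mem_D0 hu.mem hφ hε
  have hI : Integrable fun p => diffQuot s φ p ^ 2 - diffQuot s u p *
      diffQuot s (fun x => φ x ^ 2 / (|u x| + ε)) p :=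
    (hφ.hasFiniteEnergy hA.one_le hA.exponent).integrable_sq.sub
      ((hA.hasFiniteEnergy hu.mem).integrable_mul (hA.hasFiniteEnergy hψ))
  rw [← ofReal_integral_eq_lintegral_ofReal hI
    (Eventually.of_forall (diffQuot_sq_sub_nonneg hu0 hε)), ← hu.picone hA h1 hφ hε]
  refine ENNReal.ofReal_le_ofReal (le_add_of_nonneg_right (mul_nonneg hu.pos.le ?_))
  exact integral_nonneg (rpow_sub_two_mul_mul_sq_div_nonneg hu0 hε)

/-- The strong minimum principle for non-negative eigenfunctions. -/
lemma IsEigenfunction.ae_pos_of_nonneg (hA : Admissible Ω s q)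
    (hu : IsEigenfunction Ω s q lam u) (h1 : ∫ x in Ω, |u x| ^ q = 1) (hu0 : ∀ x, 0 ≤ u x) :
    ∀ᵐ x ∂volume.restrict Ω, 0 < u x := by
  refine ae_restrict_of_forall_isTestFunction hA.isOpen fun φ hφ hφ0 => ?_
  set e : ℕ → ℝ := fun n => 1 / ((n : ℝ) + 1) with he
  have he0 : ∀ n, 0 < e n := fun n => Nat.one_div_pos_of_nat
  have het : Tendsto e atTop (𝓝 0) := tendsto_one_div_add_atTop_nhds_zero_nat
  set R : ℕ → EuclideanSpace ℝ (Fin N) × EuclideanSpace ℝ (Fin N) → ℝ≥0∞ := fun n p =>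
    ENNReal.ofReal (diffQuot s φ p ^ 2 - diffQuot s u p *
      diffQuot s (fun x => φ x ^ 2 / (|u x| + e n)) p) with hR
  have hRm : ∀ n, AEMeasurable (R n) := fun n =>
    (((aemeasurable_diffQuot s hφ.continuous.aemeasurable).pow_const 2).sub
      ((aemeasurable_diffQuot s (aemeasurable_of_mem_D0 hu.mem)).mul
        (aemeasurable_diffQuot s (aemeasurable_of_mem_D0
          (hA.sq_div_mem_D0 hu.mem hφ (he0 n)))))).ennreal_ofReal
  have hfin : ∫⁻ p, liminf (fun n => R n p) atTop < ⊤ := by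
    refine (lintegral_liminf_le' hRm).trans_lt (lt_of_le_of_lt
      (b := ENNReal.ofReal (energyForm s φ φ)) ?_ ENNReal.ofReal_lt_top)
    exact liminf_le_of_frequently_le' (Eventually.of_forall fun n =>
      hu.lintegral_picone_le hA h1 hu0 hφ (he0 n)).frequently
  have hlm : AEMeasurable fun p => liminf (fun n => R n p) atTop := by
    refine ⟨fun p => liminf (fun n => (hRm n).mk _ p) atTop,
      Measurable.liminf fun n => (hRm n).measurable_mk, ?_⟩
    filter_upwards [ae_all_iff.2 fun n => (hRm n).ae_eq_mk] with p hp
    simp only [hp]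
  have hae := ae_lt_top' hlm hfin.ne
  -- By Fatou the lower limit of the remainders is finite a.e., yet at such a pair it grows like
  -- `u(x) φ(y)² / ε`. So either `u` vanishes a.e., which is excluded, or it is positive a.e. where
  -- `φ > 0`.
  have hnot : ∀ᵐ p : EuclideanSpace ℝ (Fin N) × EuclideanSpace ℝ (Fin N),
      ¬ (0 < u p.1 ∧ (u p.2 = 0 ∧ 0 < φ p.2)) := by
    filter_upwards [hae] with p hp hc
    obtain ⟨hc1, hc2, hc3⟩ := hc
    have hne : p.1 ≠ p.2 := fun he => by
      rw [he, hc2] at hc1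
      exact lt_irrefl _ hc1
    have hk : 0 < ‖p.1 - p.2‖ ^ ((N : ℝ) + 2 * s) :=
      Real.rpow_pos_of_pos (norm_pos_iff.2 (sub_ne_zero.2 hne)) _
    refine hp.ne (Tendsto.liminf_eq ?_)
    refine ENNReal.tendsto_ofReal_nhds_top.2 ?_
    have hlow : ∀ n, (u p.1 * φ p.2 ^ 2 * (e n)⁻¹ - 2 * φ p.1 * φ p.2) /
        ‖p.1 - p.2‖ ^ ((N : ℝ) + 2 * s) ≤ diffQuot s φ p ^ 2 - diffQuot s u p *
          diffQuot s (fun x => φ x ^ 2 / (|u x| + e n)) p := by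
      intro n
      rw [diffQuot_sq_sub_eq hu0 (he0 n), hc2]
      gcongr ?_ / _
      have hen := he0 n
      have ha : 0 < u p.1 + e n := by linarith
      have e1 : ((u p.1 + e n) * φ p.2 - (0 + e n) * φ p.1) ^ 2 / ((u p.1 + e n) * (0 + e n)) =
          (u p.1 * φ p.2 ^ 2 * (e n)⁻¹ - 2 * φ p.1 * φ p.2) +
            (φ p.2 ^ 2 + e n * φ p.1 ^ 2 / (u p.1 + e n)) := by
        field_simp
        ring
      rw [e1]
      exact le_add_of_nonneg_right (by positivity)
    refine tendsto_atTop_mono hlow (Tendsto.atTop_div_const hk ?_)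
    refine tendsto_atTop_add_const_right _ _ (Tendsto.const_mul_atTop (by positivity) ?_)
    refine Tendsto.inv_tendsto_nhdsGT_zero ?_
    exact tendsto_nhdsWithin_iff.2 ⟨het, Eventually.of_forall he0⟩
  rcases ae_not_or_ae_not_of_prod (P := fun x => 0 < u x)
    (R := fun x => u x = 0 ∧ 0 < φ x) hnot with h | h
  · refine absurd ?_ hu.nontrivial
    filter_upwards [h] with x hx
    exact le_antisymm (not_lt.1 hx) (hu0 x)
  · filter_upwards [ae_restrict_of_ae h] with x hx hφx
    exact lt_of_le_of_ne (hu0 x) fun hc => hx ⟨hc.symm, hφx⟩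

/-- Dropping the Picone remainder bounds `λ ∫ u^(q-1) φ²/(u+ε)` by `E(φ)`. Positivity of `u`
identifies the pointwise limit as `ε → 0`, and Fatou concludes. -/
lemma IsEigenfunction.lintegral_rpow_mul_sq_le (hA : Admissible Ω s q)
    (hu : IsEigenfunction Ω s q lam u) (h1 : ∫ x in Ω, |u x| ^ q = 1) (hu0 : ∀ x, 0 ≤ u x)
    (hφ : IsTestFunction Ω φ) :
    ∫⁻ x in Ω, ENNReal.ofReal (u x ^ (q - 2) * φ x ^ 2) ≤
      ENNReal.ofReal (energyForm s φ φ / lam) := by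
  set e : ℕ → ℝ := fun n => 1 / ((n : ℝ) + 1) with he
  have he0 : ∀ n, 0 < e n := fun n => Nat.one_div_pos_of_nat
  have het : Tendsto e atTop (𝓝 0) := tendsto_one_div_add_atTop_nhds_zero_nat
  have hψ : ∀ n, (fun x => φ x ^ 2 / (|u x| + e n)) ∈ D0 Ω s := fun n =>
    hA.sq_div_mem_D0 hu.mem hφ (he0 n)
  have hI : ∀ n, IntegrableOn
      (fun x => |u x| ^ (q - 2) * u x * (φ x ^ 2 / (|u x| + e n))) Ω := fun n =>
    integrableOn_rpow_sub_two_mul_mul hA.one_lt (aemeasurable_of_mem_D0 hu.mem)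
      (aemeasurable_of_mem_D0 (hψ n)) hu.integrableOn (hA.integrableOn_rpow (hψ n))
  calc ∫⁻ x in Ω, ENNReal.ofReal (u x ^ (q - 2) * φ x ^ 2)
      = ∫⁻ x in Ω, liminf (fun n => ENNReal.ofReal
          (|u x| ^ (q - 2) * u x * (φ x ^ 2 / (|u x| + e n)))) atTop := by
        refine lintegral_congr_ae ?_
        filter_upwards [hu.ae_pos_of_nonneg hA h1 hu0] with x hx
        refine (Tendsto.liminf_eq (ENNReal.tendsto_ofReal ?_)).symm
        rw [abs_of_pos hx]
        have h2 : Tendsto (fun n => u x ^ (q - 2) * u x * (φ x ^ 2 / (u x + e n))) atTop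
            (𝓝 (u x ^ (q - 2) * u x * (φ x ^ 2 / (u x + 0)))) :=
          (tendsto_const_nhds.div (tendsto_const_nhds.add het) (by simpa using hx.ne')).const_mul _
        convert h2 using 2
        rw [add_zero]
        field_simp
    _ ≤ liminf (fun n => ∫⁻ x in Ω, ENNReal.ofReal
          (|u x| ^ (q - 2) * u x * (φ x ^ 2 / (|u x| + e n)))) atTop :=
        lintegral_liminf_le' fun n => (hI n).aemeasurable.ennreal_ofReal
    _ ≤ ENNReal.ofReal (energyForm s φ φ / lam) := by
        refine liminf_le_of_frequently_le' (Eventually.of_forall fun n => ?_).frequently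
        rw [← ofReal_integral_eq_lintegral_ofReal (hI n)
          (Eventually.of_forall (rpow_sub_two_mul_mul_sq_div_nonneg hu0 (he0 n)))]
        refine ENNReal.ofReal_le_ofReal ?_
        rw [le_div_iff₀ hu.pos, mul_comm, ← hu.picone hA h1 hφ (he0 n)]
        exact le_add_of_nonneg_left (integral_nonneg (diffQuot_sq_sub_nonneg hu0 (he0 n)))

/-- Weighted arithmetic-geometric mean with weights `q/2` and `1 - q/2`, chosen so that the powers
of `a` cancel. -/
lemma abs_rpow_le_young {a b : ℝ} (ha : 0 < a) (hq : 0 < q) (hq2 : q < 2) :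
    |b| ^ q ≤ q / 2 * (a ^ (q - 2) * b ^ 2) + (1 - q / 2) * a ^ q := by
  have h := Real.geom_mean_le_arith_mean2_weighted (w₁ := q / 2) (w₂ := 1 - q / 2)
    (p₁ := a ^ (q - 2) * b ^ 2) (p₂ := a ^ q) (by positivity) (by linarith) (by positivity)
    (by positivity) (by ring)
  refine le_of_eq_of_le ?_ h
  rw [Real.mul_rpow (by positivity) (by positivity), ← Real.rpow_mul ha.le,
    ← Real.rpow_mul ha.le, ← sq_abs, ← Real.rpow_two, ← Real.rpow_mul (abs_nonneg _),
    mul_div_cancel₀ _ (two_ne_zero), mul_right_comm, ← Real.rpow_add ha]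
  have : (q - 2) * (q / 2) + q * (1 - q / 2) = 0 := by ring
  rw [this, Real.rpow_zero, one_mul]

lemma IsEigenfunction.le_energyForm_of_nonneg (hA : Admissible Ω s q)
    (hu : IsEigenfunction Ω s q lam u) (h1 : ∫ x in Ω, |u x| ^ q = 1) (hu0 : ∀ x, 0 ≤ u x)
    (hφ : IsTestFunction Ω φ) (hφ1 : ∫ x in Ω, |φ x| ^ q = 1) : lam ≤ energyForm s φ φ := by
  have hq : 0 < q := one_pos.trans hA.one_lt
  have hle := hu.lintegral_rpow_mul_sq_le hA h1 hu0 hφ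
  have hnn : ∀ x, 0 ≤ u x ^ (q - 2) * φ x ^ 2 := fun x =>
    mul_nonneg (Real.rpow_nonneg (hu0 x) _) (sq_nonneg _)
  have hI : IntegrableOn (fun x => u x ^ (q - 2) * φ x ^ 2) Ω := by
    refine ⟨(((aemeasurable_of_mem_D0 hu.mem).pow_const _).mul
      (hφ.continuous.aemeasurable.pow_const 2)).restrict.aestronglyMeasurable, ?_⟩
    rw [hasFiniteIntegral_iff_ofReal (Eventually.of_forall hnn)]
    exact hle.trans_lt ENNReal.ofReal_lt_top
  rw [← ofReal_integral_eq_lintegral_ofReal hI (Eventually.of_forall hnn),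
    ENNReal.ofReal_le_ofReal_iff (div_nonneg (energyForm_self_nonneg s φ) hu.pos.le),
    le_div_iff₀ hu.pos] at hle
  have hyoung : ∫ x in Ω, |φ x| ^ q ≤ ∫ x in Ω,
      (q / 2 * (u x ^ (q - 2) * φ x ^ 2) + (1 - q / 2) * |u x| ^ q) := by
    refine integral_mono_ae (hφ.integrable_rpow hq).integrableOn
      ((hI.const_mul _).add (hu.integrableOn.const_mul _)) ?_
    filter_upwards [hu.ae_pos_of_nonneg hA h1 hu0] with x hx
    rw [abs_of_pos hx]
    exact abs_rpow_le_young hx hq hA.lt_two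
  rw [integral_add (hI.const_mul _) (hu.integrableOn.const_mul _), integral_const_mul,
    integral_const_mul, h1, hφ1] at hyoung
  -- With both norms equal to one, Young reads `1 ≤ (q/2) X + 1 - q/2`.
  have hX : 1 ≤ ∫ x in Ω, u x ^ (q - 2) * φ x ^ 2 := by nlinarith
  nlinarith [hu.pos]

lemma IsEigenfunction.eq_lambdaOne_of_nonneg (hA : Admissible Ω s q)
    (hu : IsEigenfunction Ω s q lam u) (hu0 : ∀ᵐ x ∂volume.restrict Ω, 0 ≤ u x) :
    lam = (lambdaOne Ω s q).toReal := by
  refine le_antisymm ?_ (hu.lambdaOne_le hA)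
  -- Passing to `|u|` gives a representative that is nonnegative at every point, as the preceding
  -- lemmas require.
  have habs : u =ᵐ[volume] fun x => |u x| := by
    filter_upwards [(ae_restrict_iff' hA.isOpen.measurableSet).1 hu0,
      ae_eq_zero_of_mem_D0 hu.mem] with x hx hx'
    by_cases hxΩ : x ∈ Ω
    · exact (abs_of_nonneg (hx hxΩ)).symm
    · simp [hx' hxΩ]
  obtain ⟨c, hc, h1, hcu⟩ := (hu.congr hA habs).exists_normalised hA
  have hcu0 : ∀ x, 0 ≤ (c • fun x => |u x|) x := fun x => mul_nonneg hc.le (abs_nonneg _)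
  have h2 : ENNReal.ofReal lam ≤ lambdaOne Ω s q := by
    refine le_sInf ?_
    rintro _ ⟨φ, hφ, hφ1, rfl⟩
    rw [(hφ.hasFiniteEnergy hA.one_le hA.exponent).energy_eq_ofReal]
    exact ENNReal.ofReal_le_ofReal (hcu.le_energyForm_of_nonneg hA h1 hcu0 hφ hφ1)
  exact (ENNReal.ofReal_le_iff_le_toReal hA.lambdaOne_ne_top).1 h2

lemma IsEigenfunction.eq_lambdaOne_of_nonneg_or_nonpos (hA : Admissible Ω s q)
    (hu : IsEigenfunction Ω s q lam u)
    (h : (∀ᵐ x ∂volume.restrict Ω, 0 ≤ u x) ∨ ∀ᵐ x ∂volume.restrict Ω, u x ≤ 0) :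
    lam = (lambdaOne Ω s q).toReal := by
  rcases h with h | h
  · exact hu.eq_lambdaOne_of_nonneg hA h
  · refine (hu.smul hA (c := -1) (by norm_num)).eq_lambdaOne_of_nonneg hA ?_
    filter_upwards [h] with x hx
    simpa using hx

end FracEig

theorem theoremA (N : ℕ) (hN : 1 ≤ N) (s : ℝ) (hs : s ∈ Set.Ioo (0 : ℝ) 1)
    (q : ℝ) (hq : q ∈ Set.Ioo (1 : ℝ) 2)
    (Ω : Set (EuclideanSpace ℝ (Fin N))) (hΩ : IsOpen Ω) (hne : Ω.Nonempty)
    (hpos : 0 < FracEig.lambdaOne Ω s q) :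
    -- the infimum is finite, and it is a minimum over the constraint set
    FracEig.lambdaOne Ω s q ≠ ⊤ ∧
    IsLeast (FracEig.energy s '' FracEig.constraintSet Ω s q) (FracEig.lambdaOne Ω s q) ∧
    -- it is the least eigenvalue
    IsLeast (FracEig.spectrum Ω s q) (FracEig.lambdaOne Ω s q).toReal ∧
    -- its eigenfunctions are the non-zero multiples of the minimisers
    (∀ u : EuclideanSpace ℝ (Fin N) → ℝ,
      FracEig.IsEigenfunction Ω s q (FracEig.lambdaOne Ω s q).toReal u ↔
        ∃ c : ℝ, c ≠ 0 ∧ FracEig.IsMinimiser Ω s q (c • u)) ∧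
    -- minimisers, and all first eigenfunctions, are unique up to a multiplicative constant
    (∀ u v : EuclideanSpace ℝ (Fin N) → ℝ,
      FracEig.IsMinimiser Ω s q u → FracEig.IsMinimiser Ω s q v →
        ∃ c : ℝ, c ≠ 0 ∧ v =ᵐ[volume] c • u) ∧
    (∀ u v : EuclideanSpace ℝ (Fin N) → ℝ,
      FracEig.IsEigenfunction Ω s q (FracEig.lambdaOne Ω s q).toReal u →
      FracEig.IsEigenfunction Ω s q (FracEig.lambdaOne Ω s q).toReal v →
        ∃ c : ℝ, c ≠ 0 ∧ v =ᵐ[volume] c • u) ∧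
    -- first eigenfunctions have constant (strict) sign
    (∀ u : EuclideanSpace ℝ (Fin N) → ℝ,
      FracEig.IsEigenfunction Ω s q (FracEig.lambdaOne Ω s q).toReal u →
        (∀ᵐ x ∂volume.restrict Ω, 0 < u x) ∨ (∀ᵐ x ∂volume.restrict Ω, u x < 0)) ∧
    -- no other eigenvalue has an eigenfunction of constant sign
    (∀ (lam : ℝ) (u : EuclideanSpace ℝ (Fin N) → ℝ),
      FracEig.IsEigenfunction Ω s q lam u →
      ((∀ᵐ x ∂volume.restrict Ω, 0 ≤ u x) ∨ (∀ᵐ x ∂volume.restrict Ω, u x ≤ 0)) →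
        lam = (FracEig.lambdaOne Ω s q).toReal) := by
  have hA : FracEig.Admissible Ω s q := ⟨hN, hs, hq.1, hq.2, hΩ, hne, hpos⟩
  obtain ⟨u₀, hu₀⟩ := hA.exists_isMinimiser
  refine ⟨hA.lambdaOne_ne_top, ⟨⟨u₀, hu₀.1, hu₀.2⟩, ?_⟩, ⟨⟨u₀, hu₀.isEigenfunction hA⟩, ?_⟩,
    fun u => hA.isEigenfunction_iff, fun u v hu hv => hu.exists_ae_eq_smul hA hv,
    fun u v hu hv => hu.exists_ae_eq_smul hA hv, fun u hu => hu.ae_pos_or_ae_neg hA,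
    fun lam u hu h => hu.eq_lambdaOne_of_nonneg_or_nonpos hA h⟩
  · rintro _ ⟨u, hu, rfl⟩
    exact hA.lambdaOne_le_energy hu
  · rintro lam ⟨u, hu⟩
    exact hu.lambdaOne_le hA
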